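/- Fix $p\in(0,\tfrac12)$ and put $q=1-p$. Let $r_1=r_3=\frac{p}{1+p}$, $r_2=\frac{q}{1+p}$, $m_1=m_3=\frac{q}{1+q}$, $m_2=\frac{p}{1+q}$, and let $F_j(x)=r_jx+(1-r_j)p_j$ ($j=1,2,3$) with fixed points $p_1=0$, $p_2=\frac12$, $p_3=1$. On $I=[0,1]$ let $V_0=\{0,1\}$ and $V_{n+1}=\bigcup_{j}F_j(V_n)$, and write $V_n=\{x_0<x_1<\dots<x_{3^n}\}$. The interval $[x_{k},x_{k+1}]=F_{w_1}\circ\cdots\circ F_{w_n}(I)$ is an $n$-cell, with weight $m_{w_1}\cdots m_{w_n}$. The discrete Laplacian on functions $f:V_n\to\mathbb R$ is $$\Delta_nf(x_k)=f(x_k)-b_kf(x_{k-1})-a_kf(x_{k+1}),\qquad b_k=1-a_k,$$ where $a_0=1$, $a_{3^n}=0$, and for $0<k<3^n$ the probabilities $b_k,a_k$ are proportional to the weights of the $n$-cells to the left and to the right of $x_k$ (so $\{a_k,b_k\}=\{p,q\}$). The spectrum of $\Delta_n$ is simple; let $\lambda_{n,0}<\lambda_{n,1}<\dots<\lambda_{n,3^n}$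 be its eigenvalues and $f_{n,k}$ the eigenfunction with eigenvalue $\lambda_{n,k}$ normalized by $f_{n,k}(0)=1$. Let $\alpha_{n,k}$ be the real numbers with $\sum_{k=0}^{3^n}\alpha_{n,k}f_{n,k}=\delta_0^{(n)}$, where $\delta_0^{(n)}(0)=1$ and $\delta_0^{(n)}=0$ on $V_n\setminus\{0\}$. The harmonic extension to $I$ of a function on $V_n$ is its continuous extension that is affine on each $n$-cell (the minimizer of $\int_0^1|f'|^2dx$ with these values on $V_n$). Let $C_0=\frac{2+pq}{pq}$. **Theorem 5.1.** All these objects are well defined, with $\lambda_{n,1}>0$ for all $n$. For every $k\ge 0$ the limit $\lambda_k=\lim_{n\to\infty}C_0^{\,n}\lambda_{n,k}$ exists, with $\lambda_1>0$, and the harmonic extensions of $f_{n,k}$ converge uniformly on $I$, as $n\to\infty$, to a continuous function $f_k$. For $n_0\ge 0$ and $n>n_0$ let $$u_n(x,t)=\sum_{k=0}^{3^{n_0}}\alpha_{n_0,k}f_{n,k}(x)\cos\!\left(t\sqrt{\lambda_{n,k}}\right)\quad (x\in V_n),$$ extended harmonically from $V_n$ to $I$ for each $t$ (the solution of $\partial_{tt}u_n=-\Delta_nu_n$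 on $V_n$ with initial value $\delta_0^{(n_0,n)}=\sum_{k=0}^{3^{n_0}}\alpha_{n_0,k}f_{n,k}$ and initial velocity $0$), and let $$\tilde u(x,t)=\sum_{k=0}^{3^{n_0}}\alpha_{n_0,k}f_k(x)\cos\!\left(t\sqrt{\lambda_k}\right)\quad (x\in I).$$ Then for every $n_0\ge0$ there is a constant $C=C(n_0,p)>0$ such that for all $t\ge0$ and all $n>n_0$, $$\sup_{x\in I}\left|u_n\!\left(x,\frac{t\pi}{\sqrt{\lambda_{n,1}}}\right)-\tilde u\!\left(x,\frac{t\pi}{\sqrt{\lambda_1}}\right)\right|\le C\,(t\vee1)\,C_0^{-n}.$$ -/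

import Mathlib

open Filter Topology

noncomputable section

namespace FractalWave

/-! Throughout, `p` is the parameter and `q = 1 - p`.  The vertices of `V_n` are
`x_{n,0} < x_{n,1} < ... < x_{n,3^n}`; a function on `V_n` is a function of the index
`i : Fin (3 ^ n + 1)`. -/

/-- Contraction (resistance) factors `r₁ = r₃ = p / (1 + p)`, `r₂ = q / (1 + p)`. -/
def resist (p : ℝ) : Fin 3 → ℝ := ![p / (1 + p), (1 - p) / (1 + p), p / (1 + p)]

/-- Measure weights `m₁ = m₃ = q / (1 + q)`, `m₂ = p / (1 + q)`. -/
def weight (p : ℝ) : Fin 3 → ℝ :=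
  ![(1 - p) / (1 + (1 - p)), p / (1 + (1 - p)), (1 - p) / (1 + (1 - p))]

/-- Fixed points `0`, `1/2`, `1` of the contractions. -/
def fixedPt : Fin 3 → ℝ := ![0, 1 / 2, 1]

/-- The contractions `F_j x = r_j x + (1 - r_j) p_j`. -/
def contr (p : ℝ) (j : Fin 3) (x : ℝ) : ℝ := resist p j * x + (1 - resist p j) * fixedPt j

/-- The vertices `x_{n,0} < ... < x_{n,3^n}` of `V_n`, in increasing order, where
`V_0 = {0, 1}` and `V_{n+1} = F_1 V_n ∪ F_2 V_n ∪ F_3 V_n`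
(used only for indices `k ≤ 3 ^ n`). -/
def vertex (p : ℝ) : ℕ → ℕ → ℝ
  | 0, k => k
  | n + 1, k =>
    if k ≤ 3 ^ n then contr p 0 (vertex p n k)
    else if k ≤ 2 * 3 ^ n then contr p 1 (vertex p n (k - 3 ^ n))
    else contr p 2 (vertex p n (k - 2 * 3 ^ n))

/-- The measure `m_w = m_{w_1} ⋯ m_{w_n}` of the `n`-cell `[x_{n,k}, x_{n,k+1}]`
(used only for `k < 3 ^ n`). -/
def cellMass (p : ℝ) : ℕ → ℕ → ℝ
  | 0, _ => 1
  | n + 1, k =>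
    if k < 3 ^ n then weight p 0 * cellMass p n k
    else if k < 2 * 3 ^ n then weight p 1 * cellMass p n (k - 3 ^ n)
    else weight p 2 * cellMass p n (k - 2 * 3 ^ n)

/-- The probability of a step to the right from `x_{n,k}`: the walk is reflected at the two
boundary points, and at an interior vertex the two neighbours are chosen proportionally to the
weights of the corresponding cells (so that the two probabilities are `p` and `q`). -/
def stepRight (p : ℝ) (n k : ℕ) : ℝ :=
  if k = 0 then 1
  else if k = 3 ^ n then 0
  else cellMass p n k / (cellMass p n (k - 1) + cellMass p n k)

/-- The discrete Laplacian `Δ_n` on functions on `V_n`,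
`(Δ_n f)(x_k) = f(x_k) - b f(x_{k-1}) - a f(x_{k+1})`, where `a` and `b = 1 - a` are the
probabilities of a step to the right and to the left. -/
def lap (p : ℝ) (n : ℕ) : Matrix (Fin (3 ^ n + 1)) (Fin (3 ^ n + 1)) ℝ :=
  fun i j =>
    (if j = i then 1 else 0)
      - (if (j : ℕ) + 1 = i then 1 - stepRight p n i else 0)
      - (if (j : ℕ) = i + 1 then stepRight p n i else 0)

/-- The set of eigenvalues of `Δ_n`. -/
def eigSet (p : ℝ) (n : ℕ) : Set ℝ :=
  {z | ∃ f : Fin (3 ^ n + 1) → ℝ, f ≠ 0 ∧ (lap p n).mulVec f = z • f}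

/-- `λ_{n,k}`, `0 ≤ k ≤ 3 ^ n`: the eigenvalues of `Δ_n` listed in increasing order
(the spectrum is simple). -/
def eigval (p : ℝ) (n : ℕ) : ℕ → ℝ
  | 0 => sInf (eigSet p n)
  | k + 1 => sInf {z ∈ eigSet p n | eigval p n k < z}

/-- `f_{n,k}`: the eigenfunction of `Δ_n` with eigenvalue `λ_{n,k}` and value `1` at the point
`0`.  This is the normalization produced by starting from `(1, 1)` and `(1, -1)` on `V_0` and
extending eigenfunctions from each level to the next without changing the values on the old
vertices. -/
def eigfun (p : ℝ) (n k : ℕ) : Fin (3 ^ n + 1) → ℝ :=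
  Classical.epsilon fun f => (lap p n).mulVec f = eigval p n k • f ∧ f 0 = 1

/-- The weights `α_{n,k}`: the coefficients of `δ_0^{(n)}` (equal to `1` at `0` and to `0` at the
other points of `V_n`) in the basis of eigenfunctions `f_{n,k}`. -/
def coeff (p : ℝ) (n : ℕ) : Fin (3 ^ n + 1) → ℝ :=
  Classical.epsilon fun a => ∑ k : Fin (3 ^ n + 1), a k • eigfun p n k = Pi.single 0 1

/-- The harmonic extension to `I = [0, 1]` of a function on `V_n`: the continuous function with
the given values on `V_n` that is affine on every `n`-cell `[x_{n,k}, x_{n,k+1}]`, i.e. the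
minimizer of the energy `∫ |f'|²` with these values on `V_n`.  The `k`-th summand is the
increment over the `k`-th cell times the fraction of this cell that lies to the left of `x`. -/
def harmExt (p : ℝ) (n : ℕ) (u : Fin (3 ^ n + 1) → ℝ) (x : ℝ) : ℝ :=
  u 0 + ∑ k : Fin (3 ^ n), (u k.succ - u k.castSucc) *
    max 0 (min 1 ((x - vertex p n k) / (vertex p n (k + 1) - vertex p n k)))

/-- The renormalization constant `C₀ = (2 + pq) / (pq)`. -/
def renorm (p : ℝ) : ℝ := (2 + p * (1 - p)) / (p * (1 - p))

/-- `λ_k = lim C₀^n λ_{n,k}`. -/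
def limEigval (p : ℝ) (k : ℕ) : ℝ :=
  limUnder atTop fun n : ℕ => renorm p ^ n * eigval p n k

/-- `f_k = lim f_{n,k}` on `I`, the functions `f_{n,k}` being extended harmonically. -/
def limEigfun (p : ℝ) (k : ℕ) (x : ℝ) : ℝ :=
  limUnder atTop fun n : ℕ => harmExt p n (eigfun p n k) x

/-- The approximate wave `u_n(x_i, t) = ∑_{k ≤ 3^{n₀}} α_{n₀,k} f_{n,k}(x_i) cos (t √λ_{n,k})`
on `V_n`. -/
def discreteWave (p : ℝ) (n₀ n : ℕ) (t : ℝ) (i : Fin (3 ^ n + 1)) : ℝ :=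
  ∑ k : Fin (3 ^ n₀ + 1), coeff p n₀ k * eigfun p n k i * Real.cos (t * √(eigval p n k))

/-- `u_n(x, t)` for `x ∈ I`: for each `t` the harmonic extension of `u_n(·, t)` from `V_n`. -/
def waveApprox (p : ℝ) (n₀ n : ℕ) (x t : ℝ) : ℝ := harmExt p n (discreteWave p n₀ n t) x

/-- The truncated wave `ũ(x, t) = ∑_{k ≤ 3^{n₀}} α_{n₀,k} f_k(x) cos (t √λ_k)`. -/
def waveLimit (p : ℝ) (n₀ : ℕ) (x t : ℝ) : ℝ :=
  ∑ k : Fin (3 ^ n₀ + 1), coeff p n₀ k * limEigfun p k x * Real.cos (t * √(limEigval p k))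

end FractalWave

end

open FractalWave

noncomputable section

namespace FractalWave

/-! ### Refinement of cells and vertices -/

section Cells

variable {p : ℝ}

/-! The engine is spectral decimation. Subdividing a cell splits its mass in the ratio q : p : q, so
the walk at the two new vertices does not depend on the cell, and at old vertices it is unchanged.
Eliminating the new values turns the eigenvalue equation of level n+1 at z into that of level n at
R(z) = z(z² - 3z + 2 + pq)/(pq) (`decim`), unless z = 1 ± p, where the 2×2 system in the cell is
singular (`IsEigenseq.refine`).

For p < 1/2 the three inverse branches of R on [0,2] have disjoint ranges. Pulling back the spectrum
of level n, with the two singular values avoided, gives 3^(n+1) + 1 distinct eigenvalues, and a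
dimension count shows that there are no others (`eigSet_eq`). Hence for k ≤ 3^n the eigenvalue
λ_{n+1,k} is the lowest preimage of λ_{n,k} (`eigval_succ`).

Since R(0) = 0, R'(0) = C₀ and C₀z - R(z) = O(z²), the sequence C₀^n λ_{n,k} increases to a limit
with error O(C₀^{-n}) (`limEigval_spec`). The eigenfunction f_{n+1,k} extends f_{n,k} by
coefficients that at z = 0 are those of affine interpolation. Consecutive harmonic extensions
therefore differ by O(λ_{n+1,k}) = O(C₀^{-n}) (`limEigfun_spec`).

In the wave estimate the factor C₀^n cancels from the ratio of frequencies, and the Lipschitz bound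
for the cosine turns the phase error into the factor t (`mode_sub_le`). -/

theorem weight_pos (hp₀ : 0 < p) (hp : p < 1) (j : Fin 3) : 0 < weight p j := by
  fin_cases j <;> simp [weight] <;> apply div_pos <;> linarith

theorem cellMass_pos (hp₀ : 0 < p) (hp : p < 1) (n k : ℕ) : 0 < cellMass p n k := by
  induction n generalizing k with
  | zero => simp [cellMass]
  | succ n ih =>
    unfold cellMass
    split_ifs <;> exact mul_pos (weight_pos hp₀ hp _) (ih _)

/-- `cellMass` recurses on the first letter of the word, but subdividing a cell appends a last
letter. The induction peels off the first letter to pass from one to the other. -/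
theorem cellMass_refine (p : ℝ) (n k : ℕ) (hk : k < 3 ^ n) (j : Fin 3) :
    cellMass p (n + 1) (3 * k + j) = weight p j * cellMass p n k := by
  induction n generalizing k with
  | zero =>
    obtain rfl : k = 0 := by simpa using hk
    fin_cases j <;> simp [cellMass]
  | succ n ih =>
    have hj := j.isLt
    have h3 : 3 ^ (n + 1) = 3 * 3 ^ n := by ring
    rw [cellMass]
    rcases lt_or_ge k (3 ^ n) with h | h
    · rw [if_pos (by omega), ih k h, cellMass, if_pos h]
      ring
    · rcases lt_or_ge k (2 * 3 ^ n) with h' | h'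
      · rw [if_neg (by omega), if_pos (by omega),
          show 3 * k + (j : ℕ) - 3 ^ (n + 1) = 3 * (k - 3 ^ n) + j by omega,
          ih _ (by omega), cellMass, if_neg (by omega), if_pos h']
        ring
      · rw [if_neg (by omega), if_neg (by omega),
          show 3 * k + (j : ℕ) - 2 * 3 ^ (n + 1) = 3 * (k - 2 * 3 ^ n) + j by omega,
          ih _ (by omega), cellMass, if_neg (by omega), if_neg (by omega)]
        ring

@[simp] theorem stepRight_zero (p : ℝ) (n : ℕ) : stepRight p n 0 = 1 := by simp [stepRight]

@[simp] theorem stepRight_last (p : ℝ) (n : ℕ) : stepRight p n (3 ^ n) = 0 := by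
  simp [stepRight]

theorem stepRight_pos (hp₀ : 0 < p) (hp : p < 1) {n k : ℕ} (hk : k < 3 ^ n) :
    0 < stepRight p n k := by
  unfold stepRight
  split_ifs with h
  · exact one_pos
  · omega
  · exact div_pos (cellMass_pos hp₀ hp _ _)
      (add_pos (cellMass_pos hp₀ hp _ _) (cellMass_pos hp₀ hp _ _))

/-- The two new cells touching an old vertex are the last and first pieces of its neighbouring
cells. As m₁ = m₃, both masses shrink by the same factor. -/
theorem stepRight_three_mul (hp₀ : 0 < p) (hp : p < 1) {n k : ℕ} (hk : k ≤ 3 ^ n) :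
    stepRight p (n + 1) (3 * k) = stepRight p n k := by
  have h3 : 3 ^ (n + 1) = 3 * 3 ^ n := by ring
  rcases Nat.eq_zero_or_pos k with rfl | h0
  · simp
  rcases hk.eq_or_lt with rfl | h1
  · rw [← h3]; simp
  have e1 := cellMass_refine p n k h1 0
  have e2 := cellMass_refine p n (k - 1) (by omega) 2
  rw [show 3 * (k - 1) + ((2 : Fin 3) : ℕ) = 3 * k - 1 by simp; omega] at e2
  rw [show 3 * k + ((0 : Fin 3) : ℕ) = 3 * k by simp] at e1
  have hw : weight p 2 = weight p 0 := by simp [weight]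
  rw [stepRight, stepRight, if_neg (by omega), if_neg (by omega), if_neg (by omega),
    if_neg (by omega), e1, e2, hw, ← mul_add, mul_div_mul_left _ _ (weight_pos hp₀ hp 0).ne']

theorem stepRight_three_mul_add_one (hp₀ : 0 < p) (hp : p < 1) {n k : ℕ} (hk : k < 3 ^ n) :
    stepRight p (n + 1) (3 * k + 1) = p := by
  have h3 : 3 ^ (n + 1) = 3 * 3 ^ n := by ring
  have e1 := cellMass_refine p n k hk 0
  have e2 := cellMass_refine p n k hk 1
  rw [show 3 * k + ((0 : Fin 3) : ℕ) = 3 * k by simp] at e1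
  rw [show 3 * k + ((1 : Fin 3) : ℕ) = 3 * k + 1 by simp] at e2
  have hm := (cellMass_pos hp₀ hp n k).ne'
  rw [stepRight, if_neg (by omega), if_neg (by omega), show 3 * k + 1 - 1 = 3 * k by omega,
    e1, e2, ← add_mul, mul_div_mul_right _ _ hm]
  have : 1 + (1 - p) ≠ 0 := by linarith
  simp only [weight, Matrix.cons_val_zero, Matrix.cons_val_one]
  field_simp
  ring

theorem stepRight_three_mul_add_two (hp₀ : 0 < p) (hp : p < 1) {n k : ℕ} (hk : k < 3 ^ n) :
    stepRight p (n + 1) (3 * k + 2) = 1 - p := by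
  have h3 : 3 ^ (n + 1) = 3 * 3 ^ n := by ring
  have e1 := cellMass_refine p n k hk 1
  have e2 := cellMass_refine p n k hk 2
  rw [show 3 * k + ((1 : Fin 3) : ℕ) = 3 * k + 1 by simp] at e1
  rw [show 3 * k + ((2 : Fin 3) : ℕ) = 3 * k + 2 by simp] at e2
  have hm := (cellMass_pos hp₀ hp n k).ne'
  rw [stepRight, if_neg (by omega), if_neg (by omega), show 3 * k + 2 - 1 = 3 * k + 1 by omega,
    e1, e2, ← add_mul, mul_div_mul_right _ _ hm]
  have : 1 + (1 - p) ≠ 0 := by linarith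
  simp only [weight, Matrix.cons_val_one, Matrix.cons_val]
  field_simp
  ring

@[simp] theorem vertex_zero (p : ℝ) (n : ℕ) : vertex p n 0 = 0 := by
  induction n with
  | zero => simp [vertex]
  | succ n ih => simp [vertex, ih, contr, fixedPt]

@[simp] theorem vertex_last (p : ℝ) (n : ℕ) : vertex p n (3 ^ n) = 1 := by
  induction n with
  | zero => simp [vertex]
  | succ n ih =>
    have h3 : 3 ^ (n + 1) = 3 * 3 ^ n := by ring
    have h : 0 < 3 ^ n := by positivity
    rw [vertex, if_neg (by omega), if_neg (by omega),
      show 3 ^ (n + 1) - 2 * 3 ^ n = 3 ^ n by omega, ih]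
    simp [contr, fixedPt]

theorem vertex_left {n k : ℕ} (hk : k ≤ 3 ^ n) :
    vertex p (n + 1) k = contr p 0 (vertex p n k) := by
  rw [vertex, if_pos hk]

/-- Adjacent images share an endpoint, so the middle formula also holds at the index 3^n, which the
definition assigns to the first branch. -/
theorem vertex_middle (hp₀ : 0 < p) {n k : ℕ} (hk : 3 ^ n ≤ k) (hk' : k ≤ 2 * 3 ^ n) :
    vertex p (n + 1) k = contr p 1 (vertex p n (k - 3 ^ n)) := by
  rw [vertex]
  split_ifs with h
  · obtain rfl : k = 3 ^ n := by omega
    have : 1 + p ≠ 0 := by linarith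
    simp [contr, fixedPt, resist]
    field_simp
    ring
  · rfl

theorem vertex_right (hp₀ : 0 < p) {n k : ℕ} (hk : 2 * 3 ^ n ≤ k) :
    vertex p (n + 1) k = contr p 2 (vertex p n (k - 2 * 3 ^ n)) := by
  have h0 : 0 < 3 ^ n := by positivity
  rw [vertex, if_neg (by omega)]
  split_ifs with h
  · obtain rfl : k = 2 * 3 ^ n := by omega
    have : 1 + p ≠ 0 := by linarith
    rw [show 2 * 3 ^ n - 3 ^ n = 3 ^ n by omega]
    simp [contr, fixedPt, resist]
    field_simp
    ring
  · rfl

theorem resist_pos (hp₀ : 0 < p) (hp : p < 1) (j : Fin 3) : 0 < resist p j := by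
  fin_cases j <;> simp [resist] <;> apply div_pos <;> linarith

theorem vertex_lt_succ (hp₀ : 0 < p) (hp : p < 1) {n k : ℕ} (hk : k < 3 ^ n) :
    vertex p n k < vertex p n (k + 1) := by
  have hc : ∀ j x y, x < y → contr p j x < contr p j y := fun j x y h => by
    simpa [contr] using mul_lt_mul_of_pos_left h (resist_pos hp₀ hp j)
  induction n generalizing k with
  | zero => simp [vertex]
  | succ n ih =>
    have h3 : 3 ^ (n + 1) = 3 * 3 ^ n := by ring
    rcases lt_or_ge k (3 ^ n) with h | h
    · rw [vertex_left h.le, vertex_left h]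
      exact hc _ _ _ (ih h)
    rcases lt_or_ge k (2 * 3 ^ n) with h' | h'
    · rw [vertex_middle hp₀ h h'.le, vertex_middle hp₀ (by omega) h',
        show k + 1 - 3 ^ n = k - 3 ^ n + 1 by omega]
      exact hc _ _ _ (ih (by omega))
    · rw [vertex_right hp₀ h', vertex_right hp₀ (by omega),
        show k + 1 - 2 * 3 ^ n = k - 2 * 3 ^ n + 1 by omega]
      exact hc _ _ _ (ih (by omega))

/-- Within a cell the vertices of the next level divide the cell in the ratios `resist`. -/
theorem vertex_refine (hp₀ : 0 < p) {n k : ℕ} (hk : k < 3 ^ n) :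
    vertex p (n + 1) (3 * k) = vertex p n k ∧
    vertex p (n + 1) (3 * k + 1) =
      vertex p n k + resist p 0 * (vertex p n (k + 1) - vertex p n k) ∧
    vertex p (n + 1) (3 * k + 2) =
      vertex p n k + (resist p 0 + resist p 1) * (vertex p n (k + 1) - vertex p n k) ∧
    vertex p (n + 1) (3 * k + 3) = vertex p n (k + 1) := by
  induction n generalizing k with
  | zero =>
    obtain rfl : k = 0 := by simpa using hk
    have hp1 : 1 + p ≠ 0 := by linarith
    refine ⟨by simp, ?_, ?_, ?_⟩
    · rw [vertex_left (by simp)]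
      simp [vertex, contr, fixedPt]
    · rw [vertex_middle hp₀ (by simp) (by simp)]
      simp [vertex, contr, fixedPt, resist]
      field_simp
      ring
    · have := vertex_last p 1
      simpa [vertex] using this
  | succ n ih =>
    have h3 : 3 ^ (n + 1) = 3 * 3 ^ n := by ring
    rcases lt_or_ge k (3 ^ n) with h | h
    · obtain ⟨e0, e1, e2, e3⟩ := ih h
      rw [vertex_left (n := n + 1) (by omega), vertex_left (n := n + 1) (by omega),
        vertex_left (n := n + 1) (by omega), vertex_left (n := n + 1) (by omega),
        vertex_left h.le, vertex_left h, e0, e1, e2, e3]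
      simp only [contr]
      refine ⟨trivial, ?_, ?_, trivial⟩ <;> ring
    rcases lt_or_ge k (2 * 3 ^ n) with h' | h'
    · obtain ⟨e0, e1, e2, e3⟩ := ih (k := k - 3 ^ n) (by omega)
      rw [vertex_middle (n := n + 1) hp₀ (by omega) (by omega),
        vertex_middle (n := n + 1) hp₀ (by omega) (by omega),
        vertex_middle (n := n + 1) hp₀ (by omega) (by omega),
        vertex_middle (n := n + 1) hp₀ (by omega) (by omega),
        vertex_middle hp₀ h h'.le, vertex_middle hp₀ (by omega) h',
        show 3 * k - 3 ^ (n + 1) = 3 * (k - 3 ^ n) by omega,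
        show 3 * k + 1 - 3 ^ (n + 1) = 3 * (k - 3 ^ n) + 1 by omega,
        show 3 * k + 2 - 3 ^ (n + 1) = 3 * (k - 3 ^ n) + 2 by omega,
        show 3 * k + 3 - 3 ^ (n + 1) = 3 * (k - 3 ^ n) + 3 by omega,
        show k + 1 - 3 ^ n = k - 3 ^ n + 1 by omega, e0, e1, e2, e3]
      simp only [contr]
      refine ⟨trivial, ?_, ?_, trivial⟩ <;> ring
    · obtain ⟨e0, e1, e2, e3⟩ := ih (k := k - 2 * 3 ^ n) (by omega)
      rw [vertex_right (n := n + 1) (k := 3 * k) hp₀ (by omega),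
        vertex_right (n := n + 1) (k := 3 * k + 1) hp₀ (by omega),
        vertex_right (n := n + 1) (k := 3 * k + 2) hp₀ (by omega),
        vertex_right (n := n + 1) (k := 3 * k + 3) hp₀ (by omega),
        vertex_right hp₀ h', vertex_right (k := k + 1) hp₀ (by omega),
        show 3 * k - 2 * 3 ^ (n + 1) = 3 * (k - 2 * 3 ^ n) by omega,
        show 3 * k + 1 - 2 * 3 ^ (n + 1) = 3 * (k - 2 * 3 ^ n) + 1 by omega,
        show 3 * k + 2 - 2 * 3 ^ (n + 1) = 3 * (k - 2 * 3 ^ n) + 2 by omega,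
        show 3 * k + 3 - 2 * 3 ^ (n + 1) = 3 * (k - 2 * 3 ^ n) + 3 by omega,
        show k + 1 - 2 * 3 ^ n = k - 2 * 3 ^ n + 1 by omega, e0, e1, e2, e3]
      simp only [contr]
      refine ⟨trivial, ?_, ?_, trivial⟩ <;> ring

end Cells

/-! ### Harmonic extension -/

section HarmonicExtension

variable {p : ℝ}

/-- The fraction of the cell `[x_{n,k}, x_{n,k+1}]` lying to the left of `x`. -/
def cellFraction (p : ℝ) (n : ℕ) (x : ℝ) (k : ℕ) : ℝ :=
  max 0 (min 1 ((x - vertex p n k) / (vertex p n (k + 1) - vertex p n k)))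

theorem harmExt_eq_sum_range (p : ℝ) (n : ℕ) (g : ℕ → ℝ) (x : ℝ) :
    harmExt p n (fun i => g i) x =
      g 0 + ∑ k ∈ Finset.range (3 ^ n), (g (k + 1) - g k) * cellFraction p n x k := by
  rw [← Fin.sum_univ_eq_sum_range (fun k => (g (k + 1) - g k) * cellFraction p n x k)]
  simp [harmExt, cellFraction]

theorem harmExt_sub (p : ℝ) (n : ℕ) (u v : Fin (3 ^ n + 1) → ℝ) (x : ℝ) :
    harmExt p n (u - v) x = harmExt p n u x - harmExt p n v x := by
  simp only [harmExt, Pi.sub_apply]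
  rw [add_sub_add_comm, ← Finset.sum_sub_distrib]
  congr 1
  exact Finset.sum_congr rfl fun _ _ => by ring

theorem harmExt_sum {ι : Type*} (s : Finset ι) (p : ℝ) (n : ℕ) (c : ι → ℝ)
    (u : ι → Fin (3 ^ n + 1) → ℝ) (x : ℝ) :
    harmExt p n (fun i => ∑ k ∈ s, c k * u k i) x = ∑ k ∈ s, c k * harmExt p n (u k) x := by
  simp only [harmExt, mul_add, Finset.sum_add_distrib, ← Finset.sum_sub_distrib, Finset.sum_mul,
    Finset.mul_sum]
  rw [Finset.sum_comm]
  congr 1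
  exact Finset.sum_congr rfl fun _ _ => Finset.sum_congr rfl fun _ _ => by ring

theorem continuous_harmExt (p : ℝ) (n : ℕ) (u : Fin (3 ^ n + 1) → ℝ) :
    Continuous (harmExt p n u) := by
  unfold harmExt
  fun_prop

/-- Abel summation: with nonincreasing weights in [0,1] the expression is a convex combination of
the values g i. -/
theorem abs_sum_increments_le {N : ℕ} {g t : ℕ → ℝ} {M : ℝ} (hg : ∀ i ≤ N, |g i| ≤ M)
    (ht0 : ∀ i < N, 0 ≤ t i) (ht1 : ∀ i < N, t i ≤ 1) (ht : ∀ i, i + 1 < N → t (i + 1) ≤ t i) :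
    |g 0 + ∑ k ∈ Finset.range N, (g (k + 1) - g k) * t k| ≤ M := by
  -- The partial sum, with its boundary term g m * s removed, is a combination of g 0, …, g m with
  -- nonnegative weights of total 1 - s. Taking m = N and s = 0 gives the claim.
  have key : ∀ m ≤ N, ∀ s, 0 ≤ s → s ≤ 1 → (∀ j, j + 1 = m → s ≤ t j) →
      |g 0 + ∑ k ∈ Finset.range m, (g (k + 1) - g k) * t k - g m * s| ≤ M * (1 - s) := by
    intro m
    induction m with
    | zero =>
      intro _ s hs0 hs1 _
      simp only [Finset.range_zero, Finset.sum_empty, add_zero]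
      rw [show g 0 - g 0 * s = g 0 * (1 - s) by ring, abs_mul, abs_of_nonneg (sub_nonneg.2 hs1)]
      exact mul_le_mul_of_nonneg_right (hg 0 (zero_le)) (sub_nonneg.2 hs1)
    | succ m ih =>
      intro hm s hs0 _ hs
      have hsm := hs m rfl
      have h1 := ih (by omega) (t m) (ht0 m hm) (ht1 m hm)
        (fun j hj => by subst hj; exact ht j hm)
      rw [Finset.sum_range_succ]
      calc _ = |(g 0 + ∑ k ∈ Finset.range m, (g (k + 1) - g k) * t k - g m * t m) +
            g (m + 1) * (t m - s)| := by congr 1; ring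
        _ ≤ M * (1 - t m) + M * (t m - s) := by
            refine (abs_add_le _ _).trans (add_le_add h1 ?_)
            rw [abs_mul, abs_of_nonneg (sub_nonneg.2 hsm)]
            exact mul_le_mul_of_nonneg_right (hg _ hm) (sub_nonneg.2 hsm)
        _ = _ := by ring
  rcases Nat.eq_zero_or_pos N with rfl | hN
  · simpa using hg 0 le_rfl
  · simpa using key N le_rfl 0 le_rfl zero_le_one fun j hj => ht0 j (by omega)

/-- Maximum principle for the harmonic extension. -/
theorem abs_harmExt_le (hp₀ : 0 < p) (hp : p < 1) {n : ℕ} {g : ℕ → ℝ} {M : ℝ}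
    (hg : ∀ i ≤ 3 ^ n, |g i| ≤ M) (x : ℝ) : |harmExt p n (fun i => g i) x| ≤ M := by
  rw [harmExt_eq_sum_range]
  refine abs_sum_increments_le hg (fun i _ => le_max_left _ _)
    (fun i _ => max_le zero_le_one (min_le_left _ _)) fun i hi => ?_
  have h1 := vertex_lt_succ hp₀ hp (show i < 3 ^ n by omega)
  have h2 := vertex_lt_succ hp₀ hp hi
  unfold cellFraction
  -- Fractions decrease with the index: left of the shared vertex the later one is 0, right of it
  -- the earlier one is 1.
  rcases le_or_gt x (vertex p n (i + 1)) with h | h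
  · rw [max_eq_left]
    · exact le_max_left _ _
    · exact (min_le_right _ _).trans (div_nonpos_of_nonpos_of_nonneg (by linarith) (by linarith))
  · rw [min_eq_left (a := (1 : ℝ)) (b := (x - vertex p n i) / _)]
    · rw [max_eq_right (a := (0 : ℝ)) (b := 1) zero_le_one]
      exact max_le zero_le_one (min_le_left _ _)
    · rw [le_div_iff₀ (by linarith)]
      linarith

/-- Extension of a function on the vertices to the vertices of the next level: the new values in
a cell with end values `u, v` are `A u + B v` and `B u + A v`. -/
def refineFun (A B : ℝ) (f : ℕ → ℝ) (i : ℕ) : ℝ :=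
  if i % 3 = 0 then f (i / 3)
  else if i % 3 = 1 then A * f (i / 3) + B * f (i / 3 + 1)
  else B * f (i / 3) + A * f (i / 3 + 1)

@[simp] theorem refineFun_zero (A B : ℝ) (f : ℕ → ℝ) (k : ℕ) :
    refineFun A B f (3 * k) = f k := by
  simp [refineFun]

@[simp] theorem refineFun_one (A B : ℝ) (f : ℕ → ℝ) (k : ℕ) :
    refineFun A B f (3 * k + 1) = A * f k + B * f (k + 1) := by
  have h1 : (3 * k + 1) % 3 = 1 := by omega
  have h2 : (3 * k + 1) / 3 = k := by omega
  simp [refineFun, h1, h2]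

@[simp] theorem refineFun_two (A B : ℝ) (f : ℕ → ℝ) (k : ℕ) :
    refineFun A B f (3 * k + 2) = B * f k + A * f (k + 1) := by
  have h1 : (3 * k + 2) % 3 = 2 := by omega
  have h2 : (3 * k + 2) / 3 = k := by omega
  simp [refineFun, h1, h2]

@[simp] theorem refineFun_three (A B : ℝ) (f : ℕ → ℝ) (k : ℕ) :
    refineFun A B f (3 * k + 3) = f (k + 1) :=
  refineFun_zero A B f (k + 1)

theorem sum_range_three_mul (F : ℕ → ℝ) (N : ℕ) :
    ∑ i ∈ Finset.range (3 * N), F i =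
      ∑ k ∈ Finset.range N, (F (3 * k) + F (3 * k + 1) + F (3 * k + 2)) := by
  induction N with
  | zero => simp
  | succ N ih =>
    rw [Finset.sum_range_succ, ← ih, show 3 * (N + 1) = 3 * N + 1 + 1 + 1 by ring,
      Finset.sum_range_succ, Finset.sum_range_succ, Finset.sum_range_succ]
    ring

/-! ### Affine interpolation under subdivision of a cell -/

theorem mul_clamp_div {r : ℝ} (hr : 0 < r) (y : ℝ) :
    r * max 0 (min 1 (y / r)) = max 0 (min r y) := by
  rw [mul_max_of_nonneg _ _ hr.le, mul_min_of_nonneg _ _ hr.le, mul_zero, mul_one,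
    mul_div_cancel₀ _ hr.ne']

/-- Each term is the length of the part below y of one of three consecutive intervals starting at 0;
lengths add up. -/
theorem clamp_decomposition {a b c : ℝ} (ha : 0 < a) (hb : 0 < b) (hc : 0 < c) (y : ℝ) :
    max 0 (min a y) + max 0 (min b (y - a)) + max 0 (min c (y - (a + b))) =
      max 0 (min (a + b + c) y) := by
  simp only [max_def, min_def]
  split_ifs <;> linarith

theorem cellFraction_refine (hp₀ : 0 < p) (hp : p < 1) {n k : ℕ} (hk : k < 3 ^ n) (x : ℝ) :
    resist p 0 * cellFraction p (n + 1) x (3 * k) +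
      resist p 1 * cellFraction p (n + 1) x (3 * k + 1) +
      resist p 2 * cellFraction p (n + 1) x (3 * k + 2) = cellFraction p n x k := by
  obtain ⟨e0, e1, e2, e3⟩ := vertex_refine hp₀ hk
  have hL := sub_pos.2 (vertex_lt_succ hp₀ hp hk)
  have hr0 := resist_pos hp₀ hp 0
  have hr1 := resist_pos hp₀ hp 1
  have hr2 := resist_pos hp₀ hp 2
  have hsum : resist p 0 + resist p 1 + resist p 2 = 1 := by
    have : 1 + p ≠ 0 := by linarith
    simp [resist]
    field_simp
    ring
  simp only [cellFraction]
  rw [e0, e1, show 3 * k + 1 + 1 = 3 * k + 2 by ring, e2, show 3 * k + 2 + 1 = 3 * k + 3 by ring,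
    e3]
  set v := vertex p n k
  set L := vertex p n (k + 1) - v with hLdef
  have hv : vertex p n (k + 1) = v + L := by rw [hLdef]; ring
  rw [hv]
  set a := resist p 0
  set b := resist p 1
  set c := resist p 2
  have q0 : (x - v) / (v + a * L - v) = (x - v) / L / a := by field_simp; ring
  have q1 : (x - (v + a * L)) / (v + (a + b) * L - (v + a * L)) = ((x - v) / L - a) / b := by
    rw [show v + (a + b) * L - (v + a * L) = b * L by ring]; field_simp; ring
  have q2 : (x - (v + (a + b) * L)) / (v + L - (v + (a + b) * L)) =
      ((x - v) / L - (a + b)) / c := by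
    rw [show v + L - (v + (a + b) * L) = c * L by linear_combination (-L) * hsum]
    field_simp
    ring
  rw [q0, q1, q2, mul_clamp_div hr0, mul_clamp_div hr1, mul_clamp_div hr2,
    clamp_decomposition hr0 hr1 hr2, hsum]

/-- The coefficients are those of affine interpolation at the division points, since r₁ = r₃ =
p/(1+p). This allows harmonic extensions from consecutive levels to be compared on the same
vertices. -/
theorem harmExt_refine (hp₀ : 0 < p) (hp : p < 1) (n : ℕ) (f : ℕ → ℝ) (x : ℝ) :
    harmExt p (n + 1) (fun i => refineFun (1 / (1 + p)) (p / (1 + p)) f i) x =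
      harmExt p n (fun i => f i) x := by
  have h1 : 1 + p ≠ 0 := by linarith
  rw [harmExt_eq_sum_range p (n + 1) (refineFun _ _ f), harmExt_eq_sum_range, pow_succ',
    sum_range_three_mul]
  congr 1
  refine Finset.sum_congr rfl fun k hk => ?_
  rw [← cellFraction_refine hp₀ hp (Finset.mem_range.1 hk) x]
  simp only [refineFun_zero, refineFun_one, refineFun_two, refineFun_three,
    show 3 * k + 1 + 1 = 3 * k + 2 by ring, show 3 * k + 2 + 1 = 3 * k + 3 by ring]
  simp [resist]
  field_simp
  ring

end HarmonicExtension

/-! ### The decimation polynomial and its inverse branches -/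

section Decimation

variable {p : ℝ}

/-- The spectral decimation polynomial: eigenvalues of `Δ_{n+1}` are mapped to those of `Δ_n`. -/
def decim (p z : ℝ) : ℝ := z * (z ^ 2 - 3 * z + 2 + p * (1 - p)) / (p * (1 - p))

theorem continuous_decim (p : ℝ) : Continuous (decim p) := by
  unfold decim
  fun_prop

@[simp] theorem decim_zero (p : ℝ) : decim p 0 = 0 := by simp [decim]

theorem decim_self (hp₀ : 0 < p) (hp : p < 1) : decim p p = 2 := by
  have : 1 - p ≠ 0 := by linarith
  rw [decim]
  field_simp
  ring

theorem decim_one_sub (hp₀ : 0 < p) (hp : p < 1) : decim p (1 - p) = 2 := by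
  have : 1 - p ≠ 0 := by linarith
  rw [decim]
  field_simp
  ring

theorem decim_one_add (p : ℝ) : decim p (1 + p) = 0 := by
  rw [decim, div_eq_zero_iff]
  left
  ring

theorem decim_two_sub (hp₀ : 0 < p) (hp : p < 1) (z : ℝ) : decim p (2 - z) = 2 - decim p z := by
  have : 1 - p ≠ 0 := by linarith
  rw [decim, decim]
  field_simp
  ring

theorem decim_sub (p x y : ℝ) : decim p x - decim p y =
    (x - y) * (((1 - x) ^ 2 + (1 - x) * (1 - y) + (1 - y) ^ 2 - 1 + p * (1 - p)) /
      (p * (1 - p))) := by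
  rw [decim, decim]
  ring

theorem decim_strictMonoOn (hp₀ : 0 < p) (hp : p < 1 / 2) :
    StrictMonoOn (decim p) (Set.Icc 0 p) := by
  intro x hx y hy hxy
  rw [← sub_pos, decim_sub]
  refine mul_pos (sub_pos.2 hxy) (div_pos ?_ (mul_pos hp₀ (by linarith)))
  have h1 : 1 - p ≤ 1 - x := by linarith [hx.2]
  have h2 : 1 - p ≤ 1 - y := by linarith [hy.2]
  have hq : 0 < 1 - p := by linarith
  have a1 := mul_self_le_mul_self hq.le h1
  have a2 := mul_self_le_mul_self hq.le h2
  have a3 := mul_le_mul h1 h2 hq.le (hq.le.trans h1)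
  -- The form is at least 3q², and 3q² - 1 + pq = (1 - 2p)(2 - p).
  nlinarith [mul_pos (show 0 < 1 - 2 * p by linarith) (show 0 < 2 - p by linarith)]

theorem decim_strictAntiOn (hp₀ : 0 < p) (hp : p < 1 / 2) :
    StrictAntiOn (decim p) (Set.Icc (1 - p) (1 + p)) := by
  intro x hx y hy hxy
  rw [← sub_neg, decim_sub]
  refine mul_neg_of_pos_of_neg (sub_pos.2 hxy)
    (div_neg_of_neg_of_pos ?_ (mul_pos hp₀ (by linarith)))
  have a1 : (1 - x) ^ 2 ≤ p ^ 2 := sq_le_sq' (by linarith [hx.2]) (by linarith [hx.1])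
  have a2 : (1 - y) ^ 2 ≤ p ^ 2 := sq_le_sq' (by linarith [hy.2]) (by linarith [hy.1])
  -- The form is at most 3p², and 3p² - 1 + pq = -(1 - 2p)(1 + p).
  nlinarith [sq_nonneg ((1 - x) - (1 - y)),
    mul_pos (show 0 < 1 - 2 * p by linarith) (show 0 < 1 + p by linarith)]

/-- The inverse branch of `decim p` with values in `[0, p]`. -/
def lowBranch (p y : ℝ) : ℝ := Function.invFunOn (decim p) (Set.Icc 0 p) y

/-- The inverse branch of `decim p` with values in `[1 - p, 1 + p]`. -/
def midBranch (p y : ℝ) : ℝ := Function.invFunOn (decim p) (Set.Icc (1 - p) (1 + p)) y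

/-- The inverse branch of `decim p` with values in `[2 - p, 2]`. -/
def highBranch (p y : ℝ) : ℝ := 2 - lowBranch p (2 - y)

theorem lowBranch_spec (hp₀ : 0 < p) (hp : p < 1 / 2) {y : ℝ} (hy : y ∈ Set.Icc 0 2) :
    lowBranch p y ∈ Set.Icc 0 p ∧ decim p (lowBranch p y) = y := by
  have h : y ∈ decim p '' Set.Icc 0 p :=
    intermediate_value_Icc hp₀.le (continuous_decim p).continuousOn
      (by rwa [decim_zero, decim_self hp₀ (by linarith)])
  exact ⟨Function.invFunOn_mem h, Function.invFunOn_eq h⟩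

theorem midBranch_spec (hp₀ : 0 < p) (hp : p < 1 / 2) {y : ℝ} (hy : y ∈ Set.Icc 0 2) :
    midBranch p y ∈ Set.Icc (1 - p) (1 + p) ∧ decim p (midBranch p y) = y := by
  have h : y ∈ decim p '' Set.Icc (1 - p) (1 + p) :=
    intermediate_value_Icc' (by linarith) (continuous_decim p).continuousOn
      (by rwa [decim_one_add, decim_one_sub hp₀ (by linarith)])
  exact ⟨Function.invFunOn_mem h, Function.invFunOn_eq h⟩

theorem highBranch_spec (hp₀ : 0 < p) (hp : p < 1 / 2) {y : ℝ} (hy : y ∈ Set.Icc 0 2) :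
    highBranch p y ∈ Set.Icc (2 - p) 2 ∧ decim p (highBranch p y) = y := by
  obtain ⟨h1, h2⟩ := lowBranch_spec hp₀ hp (y := 2 - y) ⟨by linarith [hy.2], by linarith [hy.1]⟩
  refine ⟨⟨by unfold highBranch; linarith [h1.2], by unfold highBranch; linarith [h1.1]⟩, ?_⟩
  rw [highBranch, decim_two_sub hp₀ (by linarith), h2]
  ring

theorem lowBranch_lt (hp₀ : 0 < p) (hp : p < 1 / 2) {x y : ℝ} (hx : x ∈ Set.Icc 0 2)
    (hy : y ∈ Set.Icc 0 2) (hxy : x < y) : lowBranch p x < lowBranch p y := by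
  obtain ⟨a1, a2⟩ := lowBranch_spec hp₀ hp hx
  obtain ⟨b1, b2⟩ := lowBranch_spec hp₀ hp hy
  rwa [← (decim_strictMonoOn hp₀ hp).lt_iff_lt a1 b1, a2, b2]

theorem midBranch_lt (hp₀ : 0 < p) (hp : p < 1 / 2) {x y : ℝ} (hx : x ∈ Set.Icc 0 2)
    (hy : y ∈ Set.Icc 0 2) (hxy : x < y) : midBranch p y < midBranch p x := by
  obtain ⟨a1, a2⟩ := midBranch_spec hp₀ hp hx
  obtain ⟨b1, b2⟩ := midBranch_spec hp₀ hp hy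
  rwa [← (decim_strictAntiOn hp₀ hp).lt_iff_gt a1 b1, a2, b2]

theorem highBranch_lt (hp₀ : 0 < p) (hp : p < 1 / 2) {x y : ℝ} (hx : x ∈ Set.Icc 0 2)
    (hy : y ∈ Set.Icc 0 2) (hxy : x < y) : highBranch p x < highBranch p y := by
  have := lowBranch_lt hp₀ hp (x := 2 - y) (y := 2 - x) ⟨by linarith [hy.2], by linarith [hy.1]⟩
    ⟨by linarith [hx.2], by linarith [hx.1]⟩ (by linarith)
  unfold highBranch
  linarith

/-- The excluded endpoints 1 ± p are exactly the zeros of `cellDet`, where eigenfunctions cannot be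
extended by decimation. -/
theorem midBranch_mem_Ioo (hp₀ : 0 < p) (hp : p < 1 / 2) {y : ℝ} (hy : y ∈ Set.Ioo 0 2) :
    midBranch p y ∈ Set.Ioo (1 - p) (1 + p) := by
  obtain ⟨a1, a2⟩ := midBranch_spec hp₀ hp (Set.Ioo_subset_Icc_self hy)
  refine ⟨lt_of_le_of_ne a1.1 fun h => ?_, lt_of_le_of_ne a1.2 fun h => ?_⟩
  · rw [← h, decim_one_sub hp₀ (by linarith)] at a2
    exact hy.2.ne a2.symm
  · rw [h, decim_one_add] at a2
    exact hy.1.ne a2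

theorem lowBranch_zero (hp₀ : 0 < p) (hp : p < 1 / 2) : lowBranch p 0 = 0 := by
  obtain ⟨a1, a2⟩ := lowBranch_spec hp₀ hp (y := 0) ⟨le_rfl, zero_le_two⟩
  exact (decim_strictMonoOn hp₀ hp).injOn a1 ⟨le_rfl, hp₀.le⟩ (a2.trans (decim_zero p).symm)

end Decimation

/-! ### Eigenfunctions as solutions of a three-term recurrence -/

section Eigenfunctions

variable {p : ℝ}

/-- The restriction of `g` to the indices of `V_n` satisfies `Δ_n g = z g`. -/
def IsEigenseq (p : ℝ) (n : ℕ) (z : ℝ) (g : ℕ → ℝ) : Prop :=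
  ∀ i ≤ 3 ^ n,
    (1 - z) * g i = (1 - stepRight p n i) * g (i - 1) + stepRight p n i * g (i + 1)

/-- The out-of-range terms are harmless: at i = 0 the truncated g (i - 1) has coefficient 1 - 1, and
at i = 3^n the value g (i + 1) has coefficient 0. -/
theorem lap_mulVec_apply (p : ℝ) (n : ℕ) (g : ℕ → ℝ) (i : Fin (3 ^ n + 1)) :
    (lap p n).mulVec (fun j => g j) i =
      g i - (1 - stepRight p n i) * g (i - 1) - stepRight p n i * g (i + 1) := by
  have hi := i.isLt
  simp only [Matrix.mulVec, dotProduct, lap, sub_mul, Finset.sum_sub_distrib, ite_mul, one_mul,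
    zero_mul]
  congr 1
  · congr 1
    · simp
    · rw [Fin.sum_univ_eq_sum_range (fun j => if j + 1 = (i : ℕ) then
        g j - stepRight p n i * g j else 0)]
      rcases Nat.eq_zero_or_pos (i : ℕ) with h | h
      · simp [h]
      · rw [Finset.sum_eq_single ((i : ℕ) - 1)]
        · rw [if_pos (by omega)]
        · intro b _ hb
          rw [if_neg (by omega)]
        · intro hb
          exact absurd (Finset.mem_range.2 (by omega)) hb
  · rw [Fin.sum_univ_eq_sum_range (fun j => if j = (i : ℕ) + 1 then
        stepRight p n i * g j else 0)]
    rw [Finset.sum_ite_eq']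
    split_ifs with h
    · rfl
    · have : (i : ℕ) = 3 ^ n := by
        rw [Finset.mem_range] at h
        omega
      simp [this]

theorem isEigenseq_iff {n : ℕ} {z : ℝ} {g : ℕ → ℝ} :
    IsEigenseq p n z g ↔
      (lap p n).mulVec (fun j => g j) = z • fun j : Fin (3 ^ n + 1) => g j := by
  constructor
  · intro h
    funext i
    rw [lap_mulVec_apply, Pi.smul_apply, smul_eq_mul]
    linarith [h i (Nat.lt_succ_iff.1 i.isLt)]
  · intro h i hi
    have := congrFun h ⟨i, Nat.lt_succ_iff.2 hi⟩
    rw [lap_mulVec_apply, Pi.smul_apply, smul_eq_mul] at this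
    simp only at this
    linarith

/-- Extension by zero of a function on `V_n` to all natural indices. -/
def natExt {n : ℕ} (f : Fin (3 ^ n + 1) → ℝ) (i : ℕ) : ℝ :=
  if h : i < 3 ^ n + 1 then f ⟨i, h⟩ else 0

@[simp] theorem natExt_coe {n : ℕ} (f : Fin (3 ^ n + 1) → ℝ) (i : Fin (3 ^ n + 1)) :
    natExt f i = f i := by
  simp only [natExt, i.isLt, dif_pos]

theorem natExt_zero {n : ℕ} (f : Fin (3 ^ n + 1) → ℝ) : natExt f 0 = f 0 :=
  natExt_coe f 0

theorem isEigenseq_natExt {n : ℕ} {z : ℝ} {f : Fin (3 ^ n + 1) → ℝ} :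
    IsEigenseq p n z (natExt f) ↔ (lap p n).mulVec f = z • f := by
  simp [isEigenseq_iff]

/-- The coefficient of a step to the right is nonzero before the last vertex, so the recurrence
propagates the value at 0. Eigenspaces are thus at most one-dimensional, and an eigenfunction never
vanishes at 0. -/
theorem IsEigenseq.eq (hp₀ : 0 < p) (hp : p < 1) {n : ℕ} {z : ℝ} {g h : ℕ → ℝ}
    (hg : IsEigenseq p n z g) (hh : IsEigenseq p n z h) (h0 : g 0 = h 0) :
    ∀ i ≤ 3 ^ n, g i = h i := by
  intro i
  induction i using Nat.strong_induction_on with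
  | _ i ih =>
    intro hi
    rcases i with - | i
    · exact h0
    · have a := hg i (by omega)
      have b := hh i (by omega)
      rw [ih i (by omega) (by omega), ih (i - 1) (by omega) (by omega), b] at a
      exact (mul_left_cancel₀ (stepRight_pos hp₀ hp (by omega : i < 3 ^ n)).ne'
        (add_left_cancel a)).symm

theorem IsEigenseq.smul {n : ℕ} {z : ℝ} {g : ℕ → ℝ} (hg : IsEigenseq p n z g) (c : ℝ) :
    IsEigenseq p n z fun i => c * g i := by
  intro i hi
  linear_combination c * hg i hi

theorem isEigenseq_zero {n : ℕ} {z : ℝ} : IsEigenseq p n z fun _ => 0 := by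
  intro i _
  ring

theorem mem_eigSet_iff (hp₀ : 0 < p) (hp : p < 1) {n : ℕ} {z : ℝ} :
    z ∈ eigSet p n ↔ ∃ g : ℕ → ℝ, IsEigenseq p n z g ∧ g 0 = 1 := by
  constructor
  · rintro ⟨f, hf, hz⟩
    rw [← isEigenseq_natExt] at hz
    have h0 : natExt f 0 ≠ 0 := by
      intro h0
      apply hf
      funext i
      rw [← natExt_coe f i]
      exact hz.eq hp₀ hp isEigenseq_zero h0 i (Nat.lt_succ_iff.1 i.isLt)
    exact ⟨_, hz.smul (natExt f 0)⁻¹, inv_mul_cancel₀ h0⟩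
  · rintro ⟨g, hg, h0⟩
    refine ⟨fun i => g i, fun h => ?_, isEigenseq_iff.1 hg⟩
    have := congrFun h 0
    simp [h0] at this

/-- The determinant of the linear system for the two new values in a cell. -/
def cellDet (p z : ℝ) : ℝ := (1 - p - z) * (1 + p - z)

/-- The coefficient of the nearer end value in the eigenfunction extension. -/
def nearCoeff (p z : ℝ) : ℝ := (1 - p) * (1 - z) / cellDet p z

/-- The coefficient of the farther end value in the eigenfunction extension. -/
def farCoeff (p z : ℝ) : ℝ := p * (1 - p) / cellDet p z

/-- Spectral decimation: extension of eigenfunctions to the next level. -/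
theorem IsEigenseq.refine (hp₀ : 0 < p) (hp : p < 1) {n : ℕ} {z : ℝ} {f : ℕ → ℝ}
    (hf : IsEigenseq p n (decim p z) f) (hz : cellDet p z ≠ 0) :
    IsEigenseq p (n + 1) z (refineFun (nearCoeff p z) (farCoeff p z) f) := by
  have hq : 1 - p ≠ 0 := by linarith
  have h3 : 3 ^ (n + 1) = 3 * 3 ^ n := by ring
  have eA : nearCoeff p z * cellDet p z = (1 - p) * (1 - z) := div_mul_cancel₀ _ hz
  have eB : farCoeff p z * cellDet p z = p * (1 - p) := div_mul_cancel₀ _ hz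
  -- The equation at an old vertex, once the neighbouring old values are eliminated by the equation
  -- of level n.
  have key : nearCoeff p z + farCoeff p z * (1 - decim p z) = 1 - z := by
    apply mul_right_cancel₀ hz
    rw [add_mul, mul_right_comm, eA, eB, decim, cellDet]
    field_simp
    ring
  -- `k1` and `k2` are the equations at a new vertex, split into the coefficients of the nearer and
  -- the farther end value.
  have k1 : (1 - z) * nearCoeff p z = (1 - p) + p * farCoeff p z := by
    apply mul_right_cancel₀ hz
    rw [mul_assoc, eA, add_mul, mul_assoc, eB, cellDet]
    ring
  have k2 : (1 - z) * farCoeff p z = p * nearCoeff p z := by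
    apply mul_right_cancel₀ hz
    rw [mul_assoc, eB, mul_assoc, eA]
    ring
  intro i hi
  obtain ⟨k, rfl | rfl | rfl⟩ : ∃ k, i = 3 * k ∨ i = 3 * k + 1 ∨ i = 3 * k + 2 :=
    ⟨i / 3, by omega⟩
  · rw [stepRight_three_mul hp₀ hp (by omega), refineFun_zero, refineFun_one]
    have hk := hf k (by omega)
    rcases k with - | k
    · simp only [stepRight_zero, zero_add] at hk ⊢
      linear_combination (-f 0) * key + farCoeff p z * hk
    · rw [show 3 * (k + 1) - 1 = 3 * k + 2 by omega, refineFun_two]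
      rw [show k + 1 - 1 = k by omega] at hk
      linear_combination (-f (k + 1)) * key + farCoeff p z * hk
  · rw [stepRight_three_mul_add_one hp₀ hp (by omega), show 3 * k + 1 - 1 = 3 * k by omega,
      show 3 * k + 1 + 1 = 3 * k + 2 by ring, refineFun_zero, refineFun_one, refineFun_two]
    linear_combination f k * k1 + f (k + 1) * k2
  · rw [stepRight_three_mul_add_two hp₀ hp (by omega), show 3 * k + 2 - 1 = 3 * k + 1 by omega,
      show 3 * k + 2 + 1 = 3 * k + 3 by ring, refineFun_three, refineFun_one, refineFun_two]
    linear_combination f (k + 1) * k1 + f k * k2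

theorem mem_eigSet_succ (hp₀ : 0 < p) (hp : p < 1) {n : ℕ} {z : ℝ}
    (h : decim p z ∈ eigSet p n) (hz : cellDet p z ≠ 0) : z ∈ eigSet p (n + 1) := by
  rw [mem_eigSet_iff hp₀ hp] at h ⊢
  obtain ⟨f, hf, h0⟩ := h
  exact ⟨_, hf.refine hp₀ hp hz, by simpa using (refineFun_zero _ _ f 0).trans h0⟩

end Eigenfunctions

/-! ### The spectrum -/

section Spectrum

variable {p : ℝ}

/-- The eigenvalues of `Δ_n` in increasing order, obtained by inverting the decimation
polynomial. -/
def specList (p : ℝ) : ℕ → ℕ → ℝ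
  | 0, k => 2 * k
  | n + 1, k =>
    if k ≤ 3 ^ n then lowBranch p (specList p n k)
    else if k < 2 * 3 ^ n then midBranch p (specList p n (2 * 3 ^ n - k))
    else highBranch p (specList p n (k - 2 * 3 ^ n))

theorem specList_mem_Icc (hp₀ : 0 < p) (hp : p < 1 / 2) {n k : ℕ} (hk : k ≤ 3 ^ n) :
    specList p n k ∈ Set.Icc 0 2 := by
  induction n generalizing k with
  | zero =>
    have : (k : ℝ) ≤ 1 := by exact_mod_cast hk
    exact ⟨by simp [specList], by simp [specList]; linarith⟩
  | succ n ih =>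
    have h3 : 3 ^ (n + 1) = 3 * 3 ^ n := by ring
    rw [specList]
    split_ifs with h h'
    · have := (lowBranch_spec hp₀ hp (ih h)).1
      exact ⟨this.1, by linarith [this.2]⟩
    · have := (midBranch_spec hp₀ hp (ih (k := 2 * 3 ^ n - k) (by omega))).1
      exact ⟨by linarith [this.1], by linarith [this.2]⟩
    · have := (highBranch_spec hp₀ hp (ih (k := k - 2 * 3 ^ n) (by omega))).1
      exact ⟨by linarith [this.1], this.2⟩

theorem specList_strictMonoOn (hp₀ : 0 < p) (hp : p < 1 / 2) (n : ℕ) :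
    StrictMonoOn (specList p n) (Set.Iic (3 ^ n)) := by
  induction n with
  | zero =>
    intro i _ j _ hij
    simpa [specList] using hij
  | succ n ih =>
    have h3 : 3 ^ (n + 1) = 3 * 3 ^ n := by ring
    have hI : ∀ {k}, k ≤ 3 ^ n → specList p n k ∈ Set.Icc 0 2 :=
      fun hk => specList_mem_Icc hp₀ hp hk
    have hlt : ∀ {i j}, i < j → j ≤ 3 ^ n → specList p n i < specList p n j :=
      fun hij hj => ih (Set.mem_Iic.2 (by omega)) (Set.mem_Iic.2 hj) hij
    have hlow : ∀ {k}, k ≤ 3 ^ n → lowBranch p (specList p n k) ≤ p :=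
      fun hk => (lowBranch_spec hp₀ hp (hI hk)).1.2
    have hmid : ∀ {k}, k ≤ 3 ^ n → midBranch p (specList p n k) ∈ Set.Icc (1 - p) (1 + p) :=
      fun hk => (midBranch_spec hp₀ hp (hI hk)).1
    have hhigh : ∀ {k}, k ≤ 3 ^ n → 2 - p ≤ highBranch p (specList p n k) :=
      fun hk => (highBranch_spec hp₀ hp (hI hk)).1.1
    intro i hi j hj hij
    rw [Set.mem_Iic] at hi hj
    rw [specList, specList]
    split_ifs with h1 h2 h3 h4 h5 h6 h7
    · exact lowBranch_lt hp₀ hp (hI h1) (hI h2) (hlt hij h2)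
    · have := hmid (k := 2 * 3 ^ n - j) (by omega)
      linarith [hlow h1, this.1]
    · have := hhigh (k := j - 2 * 3 ^ n) (by omega)
      linarith [hlow h1]
    · omega
    · exact midBranch_lt hp₀ hp (hI (by omega)) (hI (by omega)) (hlt (by omega) (by omega))
    · have := hhigh (k := j - 2 * 3 ^ n) (by omega)
      have := hmid (k := 2 * 3 ^ n - i) (by omega)
      linarith [this.2]
    · omega
    · omega
    · exact highBranch_lt hp₀ hp (hI (by omega)) (hI (by omega)) (hlt (by omega) (by omega))

theorem specList_zero (hp₀ : 0 < p) (hp : p < 1 / 2) (n : ℕ) : specList p n 0 = 0 := by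
  induction n with
  | zero => simp [specList]
  | succ n ih => rw [specList, if_pos (zero_le), ih, lowBranch_zero hp₀ hp]

theorem specList_mem_Ioo (hp₀ : 0 < p) (hp : p < 1 / 2) {n k : ℕ} (hk : 0 < k)
    (hk' : k < 3 ^ n) : specList p n k ∈ Set.Ioo 0 2 := by
  have hm := specList_strictMonoOn hp₀ hp n
  constructor
  · rw [← specList_zero hp₀ hp n]
    exact hm (Set.mem_Iic.2 (zero_le)) (Set.mem_Iic.2 hk'.le) hk
  · exact (hm (Set.mem_Iic.2 hk'.le) (Set.mem_Iic.2 le_rfl) hk').trans_le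
      (specList_mem_Icc hp₀ hp le_rfl).2

theorem specList_mem_eigSet (hp₀ : 0 < p) (hp : p < 1 / 2) {n k : ℕ} (hk : k ≤ 3 ^ n) :
    specList p n k ∈ eigSet p n := by
  induction n generalizing k with
  | zero =>
    rw [mem_eigSet_iff hp₀ (by linarith)]
    have h1 : stepRight p 0 1 = 0 := by simpa using stepRight_last p 0
    have hk' : k = 0 ∨ k = 1 := by
      have : k ≤ 1 := by simpa using hk
      omega
    refine ⟨fun i => if i = 0 then 1 else 1 - specList p 0 k, fun i hi => ?_, by simp⟩
    have hi' : i = 0 ∨ i = 1 := by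
      have : i ≤ 1 := by simpa using hi
      omega
    rcases hi' with rfl | rfl
    · simp
    · rcases hk' with rfl | rfl <;> simp [specList, h1]
      norm_num
  | succ n ih =>
    have h3 : 3 ^ (n + 1) = 3 * 3 ^ n := by ring
    rw [specList]
    split_ifs with h h'
    · obtain ⟨h1, h2⟩ := lowBranch_spec hp₀ hp (specList_mem_Icc hp₀ hp h)
      refine mem_eigSet_succ hp₀ (by linarith) (h2.symm ▸ ih h) (mul_ne_zero ?_ ?_) <;>
        linarith [h1.1, h1.2]
    -- Here 0 < 2·3^n - k < 3^n, so the eigenvalue pulled back is neither 0 nor 2 and the preimage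
    -- avoids 1 ± p.
    · have hI := specList_mem_Ioo hp₀ hp (n := n) (k := 2 * 3 ^ n - k) (by omega) (by omega)
      have h2 := (midBranch_spec hp₀ hp (Set.Ioo_subset_Icc_self hI)).2
      have h1 := midBranch_mem_Ioo hp₀ hp hI
      refine mem_eigSet_succ hp₀ (by linarith) (h2.symm ▸ ih (by omega)) (mul_ne_zero ?_ ?_)
      · linarith [h1.1]
      · linarith [h1.2]
    · obtain ⟨h1, h2⟩ := highBranch_spec hp₀ hp
        (specList_mem_Icc hp₀ hp (n := n) (k := k - 2 * 3 ^ n) (by omega))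
      refine mem_eigSet_succ hp₀ (by linarith) (h2.symm ▸ ih (by omega)) (mul_ne_zero ?_ ?_) <;>
        linarith [h1.1, h1.2]

theorem linearIndependent_eigenvectors {n : ℕ} {ι : Type*} (μ : ι → ℝ)
    (hμ : Function.Injective μ) (v : ι → Fin (3 ^ n + 1) → ℝ) (hv : ∀ i, v i ≠ 0)
    (h : ∀ i, (lap p n).mulVec (v i) = μ i • v i) : LinearIndependent ℝ v :=
  Module.End.eigenvectors_linearIndependent' (Matrix.toLin' (lap p n)) μ hμ v fun i =>
    Module.End.hasEigenvector_iff.2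
      ⟨Module.End.mem_eigenspace_iff.2 (by rw [Matrix.toLin'_apply, h i]), hv i⟩

/-- Eigenvectors for distinct eigenvalues are independent, so there are at most 3^n + 1 eigenvalues;
`specList` already supplies that many. -/
theorem eigSet_eq (hp₀ : 0 < p) (hp : p < 1 / 2) (n : ℕ) :
    eigSet p n = specList p n '' Set.Iic (3 ^ n) := by
  choose v hv hv' using fun z : eigSet p n => z.2
  have hli := linearIndependent_eigenvectors (p := p) (fun z : eigSet p n => (z : ℝ))
    Subtype.val_injective v hv hv'
  have hfin : Finite (eigSet p n) := hli.finite
  have hsub : specList p n '' Set.Iic (3 ^ n) ⊆ eigSet p n := by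
    rintro _ ⟨k, hk, rfl⟩
    exact specList_mem_eigSet hp₀ hp hk
  refine (Set.eq_of_subset_of_ncard_le hsub ?_ (Set.toFinite _)).symm
  rw [(specList_strictMonoOn hp₀ hp n).injOn.ncard_image]
  have : Fintype (eigSet p n) := Fintype.ofFinite _
  have hcard := hli.fintype_card_le_finrank
  rw [Module.finrank_fin_fun, ← Nat.card_eq_fintype_card, Nat.card_coe_set_eq] at hcard
  rwa [show Set.Iic (3 ^ n) = ((Finset.Iic (3 ^ n) : Finset ℕ) : Set ℕ) by simp,
    Set.ncard_coe_finset, Nat.card_Iic]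

theorem eigval_eq (hp₀ : 0 < p) (hp : p < 1 / 2) {n k : ℕ} (hk : k ≤ 3 ^ n) :
    eigval p n k = specList p n k := by
  have hm := specList_strictMonoOn hp₀ hp n
  induction k with
  | zero =>
    rw [eigval, eigSet_eq hp₀ hp]
    refine IsLeast.csInf_eq ⟨⟨0, Set.mem_Iic.2 hk, rfl⟩, ?_⟩
    rintro _ ⟨j, hj, rfl⟩
    exact hm.monotoneOn (Set.mem_Iic.2 hk) hj (zero_le)
  | succ k ih =>
    rw [eigval, eigSet_eq hp₀ hp, ih (by omega)]
    have hk' : k ∈ Set.Iic (3 ^ n) := Set.mem_Iic.2 (by omega)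
    refine IsLeast.csInf_eq ⟨⟨⟨k + 1, Set.mem_Iic.2 hk, rfl⟩,
      hm hk' (Set.mem_Iic.2 hk) (Nat.lt_succ_self k)⟩, ?_⟩
    rintro _ ⟨⟨j, hj, rfl⟩, hlt⟩
    have : k < j := (hm.lt_iff_lt hk' hj).1 hlt
    exact hm.monotoneOn (Set.mem_Iic.2 hk) hj this

theorem eigfun_spec (hp₀ : 0 < p) (hp : p < 1 / 2) {n k : ℕ} (hk : k ≤ 3 ^ n) :
    (lap p n).mulVec (eigfun p n k) = eigval p n k • eigfun p n k ∧ eigfun p n k 0 = 1 := by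
  have h := specList_mem_eigSet hp₀ hp hk
  rw [← eigval_eq hp₀ hp hk, mem_eigSet_iff hp₀ (by linarith)] at h
  obtain ⟨g, hg, h0⟩ := h
  exact Classical.epsilon_spec (p := fun f : Fin (3 ^ n + 1) → ℝ =>
    (lap p n).mulVec f = eigval p n k • f ∧ f 0 = 1) ⟨fun i => g i, isEigenseq_iff.1 hg, h0⟩

theorem coeff_spec (hp₀ : 0 < p) (hp : p < 1 / 2) (n : ℕ) :
    ∑ k : Fin (3 ^ n + 1), coeff p n k • eigfun p n k = Pi.single 0 1 := by
  have hle : ∀ k : Fin (3 ^ n + 1), (k : ℕ) ≤ 3 ^ n := fun k => Nat.lt_succ_iff.1 k.isLt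
  have hli : LinearIndependent ℝ fun k : Fin (3 ^ n + 1) => eigfun p n k := by
    refine linearIndependent_eigenvectors (fun k : Fin (3 ^ n + 1) => eigval p n k) ?_ _ ?_
      fun k => (eigfun_spec hp₀ hp (hle k)).1
    · intro i j hij
      simp only [eigval_eq hp₀ hp (hle _)] at hij
      exact Fin.ext ((specList_strictMonoOn hp₀ hp n).injOn (hle i) (hle j) hij)
    · intro k h
      have := (eigfun_spec hp₀ hp (hle k)).2
      rw [h] at this
      simp at this
  have hspan := hli.span_eq_top_of_card_eq_finrank' (by simp)
  obtain ⟨a, ha⟩ := (Submodule.mem_span_range_iff_exists_fun ℝ).1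
    (hspan ▸ Submodule.mem_top : (Pi.single 0 1 : Fin (3 ^ n + 1) → ℝ) ∈ _)
  exact Classical.epsilon_spec (p := fun a : Fin (3 ^ n + 1) → ℝ =>
    ∑ k : Fin (3 ^ n + 1), a k • eigfun p n k = Pi.single 0 1) ⟨a, ha⟩

theorem eigval_zero (hp₀ : 0 < p) (hp : p < 1 / 2) (n : ℕ) : eigval p n 0 = 0 := by
  rw [eigval_eq hp₀ hp (zero_le), specList_zero hp₀ hp]

theorem eigval_pos (hp₀ : 0 < p) (hp : p < 1 / 2) {n k : ℕ} (hk₀ : 0 < k) (hk : k ≤ 3 ^ n) :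
    0 < eigval p n k := by
  rw [eigval_eq hp₀ hp hk, ← specList_zero hp₀ hp n]
  exact specList_strictMonoOn hp₀ hp n (Set.mem_Iic.2 (zero_le)) (Set.mem_Iic.2 hk) hk₀

theorem eigval_mem_Icc (hp₀ : 0 < p) (hp : p < 1 / 2) {n k : ℕ} (hk : k ≤ 3 ^ n) :
    eigval p n k ∈ Set.Icc 0 2 :=
  eigval_eq hp₀ hp hk ▸ specList_mem_Icc hp₀ hp hk

/-- The low branch keeps the index k, so a fixed mode evolves by iterating one inverse branch. All
the asymptotics rest on this. -/
theorem eigval_succ (hp₀ : 0 < p) (hp : p < 1 / 2) {n k : ℕ} (hk : k ≤ 3 ^ n) :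
    eigval p (n + 1) k ∈ Set.Icc 0 p ∧ decim p (eigval p (n + 1) k) = eigval p n k := by
  have h3 : 3 ^ (n + 1) = 3 * 3 ^ n := by ring
  rw [eigval_eq hp₀ hp hk, eigval_eq hp₀ hp (by omega), specList, if_pos hk]
  exact lowBranch_spec hp₀ hp (specList_mem_Icc hp₀ hp hk)

theorem cellDet_pos (hp₀ : 0 < p) (hp : p < 1 / 2) {z : ℝ} (hz : z ∈ Set.Icc 0 p) :
    0 < cellDet p z :=
  mul_pos (by linarith [hz.2]) (by linarith [hz.2])

/-- Eigenfunctions extend those of the previous level. -/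
theorem eigfun_succ (hp₀ : 0 < p) (hp : p < 1 / 2) {n k : ℕ} (hk : k ≤ 3 ^ n) :
    ∀ i ≤ 3 ^ (n + 1), natExt (eigfun p (n + 1) k) i =
      refineFun (nearCoeff p (eigval p (n + 1) k)) (farCoeff p (eigval p (n + 1) k))
        (natExt (eigfun p n k)) i := by
  have h3 : 3 ^ (n + 1) = 3 * 3 ^ n := by ring
  obtain ⟨hz, hd⟩ := eigval_succ hp₀ hp hk
  obtain ⟨a1, a0⟩ := eigfun_spec hp₀ hp (n := n + 1) (k := k) (by omega)
  obtain ⟨b1, b0⟩ := eigfun_spec hp₀ hp hk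
  rw [← isEigenseq_natExt] at a1 b1
  rw [← hd] at b1
  refine a1.eq hp₀ (by linarith) (b1.refine hp₀ (by linarith) (cellDet_pos hp₀ hp hz).ne') ?_
  rw [natExt_zero, a0]
  exact ((refineFun_zero _ _ _ 0).trans ((natExt_zero _).trans b0)).symm

end Spectrum

/-! ### Renormalized limits of eigenvalues -/

/-- The bound is required only from n₀ on because a mode k exists only at levels with k ≤ 3^n. -/
theorem exists_limit_of_geometric {a : ℕ → ℝ} {r K : ℝ} (hr : r < 1) (n₀ : ℕ)
    (h : ∀ m, n₀ ≤ m → |a (m + 1) - a m| ≤ K * r ^ m) :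
    ∃ l, Tendsto a atTop (𝓝 l) ∧ ∀ m, n₀ ≤ m → |a m - l| ≤ K / (1 - r) * r ^ m := by
  have hd : ∀ m, dist (a (m + n₀)) (a (m + 1 + n₀)) ≤ K * r ^ n₀ * r ^ m := fun m => by
    rw [dist_comm, Real.dist_eq, mul_assoc, ← pow_add, add_comm n₀ m, add_right_comm]
    exact h _ (by omega)
  obtain ⟨l, hl⟩ := cauchySeq_tendsto_of_complete
    (cauchySeq_of_le_geometric (f := fun m => a (m + n₀)) r _ hr hd)
  refine ⟨l, (tendsto_add_atTop_iff_nat n₀).1 hl, fun m hm => ?_⟩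
  have := dist_le_of_le_geometric_of_tendsto r _ hr hd hl (m - n₀)
  rw [Nat.sub_add_cancel hm, Real.dist_eq, mul_assoc, ← pow_add, Nat.add_sub_cancel' hm] at this
  rwa [div_mul_eq_mul_div]

section Limits

variable {p : ℝ}

theorem one_lt_renorm (hp₀ : 0 < p) (hp : p < 1) : 1 < renorm p := by
  have : 0 < p * (1 - p) := mul_pos hp₀ (by linarith)
  rw [renorm, one_lt_div this]
  linarith

/-- `renorm p` is the derivative of `decim p` at 0; the quadratic remainder drives the convergence.
-/
theorem renorm_mul_sub_decim (hp₀ : 0 < p) (hp : p < 1) (z : ℝ) :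
    renorm p * z - decim p z = (3 * z ^ 2 - z ^ 3) / (p * (1 - p)) := by
  have : 1 - p ≠ 0 := by linarith
  rw [renorm, decim]
  field_simp
  ring

/-- The cubic is concave on [0,p], hence lies above its chord from (0,0) to (p,2). -/
theorem two_div_mul_le_decim (hp₀ : 0 < p) (hp : p < 1 / 2) {z : ℝ} (hz : z ∈ Set.Icc 0 p) :
    2 / p * z ≤ decim p z := by
  have hq : 0 < 1 - p := by linarith
  have : decim p z - 2 / p * z = z * ((p - z) * (3 - z - p)) / (p * (1 - p)) := by
    rw [decim]
    field_simp
    ring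
  rw [← sub_nonneg, this]
  have := hz.2
  exact div_nonneg (mul_nonneg hz.1 (mul_nonneg (by linarith) (by linarith)))
    (mul_pos hp₀ hq).le

/-- The square of the chord slope 2/p exceeds `renorm p`, so a quadratic term gains more in one step
than renormalization costs. -/
theorem renorm_lt (hp₀ : 0 < p) (hp : p < 1 / 2) : renorm p < 4 / p ^ 2 := by
  have hq : 0 < 1 - p := by linarith
  rw [renorm, div_lt_div_iff₀ (mul_pos hp₀ hq) (by positivity)]
  nlinarith [mul_pos hp₀ hq, mul_pos hp₀ (mul_pos hp₀ hq)]

/-- A quadratic Lyapunov function for the inverse iteration of the decimation polynomial. -/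
theorem exists_lyapunov (hp₀ : 0 < p) (hp : p < 1 / 2) :
    ∃ K : ℝ, 0 ≤ K ∧ ∀ z ∈ Set.Icc 0 p,
      renorm p * (z + K * z ^ 2) ≤ decim p z + K * decim p z ^ 2 := by
  have hpq : 0 < p * (1 - p) := mul_pos hp₀ (by linarith)
  have hd : 0 < 4 / p ^ 2 - renorm p := sub_pos.2 (renorm_lt hp₀ hp)
  -- K is chosen so that the gain K(4/p² - C₀)z² equals the bound 3z²/(pq) for the defect C₀z -
  -- R(z).
  refine ⟨3 / (p * (1 - p)) / (4 / p ^ 2 - renorm p), by positivity, fun z hz => ?_⟩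
  set K := 3 / (p * (1 - p)) / (4 / p ^ 2 - renorm p) with hK
  have hK0 : 0 ≤ K := by positivity
  have hKe : K * (4 / p ^ 2 - renorm p) = 3 / (p * (1 - p)) := div_mul_cancel₀ _ hd.ne'
  have h1 := renorm_mul_sub_decim hp₀ (by linarith) z
  have h2 : (3 * z ^ 2 - z ^ 3) / (p * (1 - p)) ≤ 3 / (p * (1 - p)) * z ^ 2 := by
    rw [div_mul_eq_mul_div]
    have := pow_nonneg hz.1 3
    gcongr
    linarith
  have h3 : (2 / p * z) ^ 2 ≤ decim p z ^ 2 :=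
    pow_le_pow_left₀ (mul_nonneg (by positivity) hz.1) (two_div_mul_le_decim hp₀ hp hz) 2
  have h4 := mul_le_mul_of_nonneg_left h3 hK0
  have h5 : K * (2 / p * z) ^ 2 - renorm p * (K * z ^ 2) = 3 / (p * (1 - p)) * z ^ 2 := by
    rw [← hKe]
    ring
  linarith

/-- The sequence C₀^m (λ_m + Kλ_m²) is nonincreasing by `exists_lyapunov`, and it dominates C₀^m
λ_m. -/
theorem renorm_pow_mul_bounded (hp₀ : 0 < p) (hp : p < 1 / 2) {lam : ℕ → ℝ} {n₀ : ℕ}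
    (h0 : 0 ≤ lam n₀)
    (h : ∀ m, n₀ ≤ m → lam (m + 1) ∈ Set.Icc 0 p ∧ decim p (lam (m + 1)) = lam m) :
    ∃ M : ℝ, 0 ≤ M ∧ ∀ m, n₀ ≤ m → renorm p ^ m * lam m ≤ M := by
  obtain ⟨K, hK, hL⟩ := exists_lyapunov hp₀ hp
  have hc : 0 < renorm p := one_pos.trans (one_lt_renorm hp₀ (by linarith))
  refine ⟨renorm p ^ n₀ * (lam n₀ + K * lam n₀ ^ 2), by positivity, fun m hm => ?_⟩
  have key : renorm p ^ m * (lam m + K * lam m ^ 2) ≤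
      renorm p ^ n₀ * (lam n₀ + K * lam n₀ ^ 2) := by
    induction m, hm using Nat.le_induction with
    | base => exact le_rfl
    | succ m hm ih =>
      obtain ⟨h1, h2⟩ := h m hm
      refine le_trans ?_ ih
      rw [pow_succ, mul_assoc]
      have := hL _ h1
      rw [h2] at this
      gcongr
  refine le_trans ?_ key
  gcongr
  nlinarith [mul_nonneg hK (sq_nonneg (lam m))]

theorem renorm_pow_mul_increment (hp₀ : 0 < p) (hp : p < 1) {z y : ℝ} (m : ℕ)
    (hy : decim p z = y) :
    renorm p ^ (m + 1) * z - renorm p ^ m * y =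
      renorm p ^ m * ((3 * z ^ 2 - z ^ 3) / (p * (1 - p))) := by
  rw [← hy, ← renorm_mul_sub_decim hp₀ hp]
  ring

theorem eigval_le_geometric (hp₀ : 0 < p) (hp : p < 1 / 2) {n₀ k : ℕ} (hk : k ≤ 3 ^ n₀) :
    ∃ M : ℝ, 0 ≤ M ∧ ∀ m, n₀ ≤ m → eigval p m k ≤ M * (renorm p)⁻¹ ^ m := by
  obtain ⟨M, hM, h⟩ := renorm_pow_mul_bounded hp₀ hp (lam := fun m => eigval p m k)
    (eigval_mem_Icc hp₀ hp hk).1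
    (fun m hm => eigval_succ hp₀ hp (hk.trans (Nat.pow_le_pow_right (by norm_num) hm)))
  have hc : 0 < renorm p := one_pos.trans (one_lt_renorm hp₀ (by linarith))
  refine ⟨M, hM, fun m hm => ?_⟩
  rw [inv_pow, ← div_eq_mul_inv, le_div_iff₀ (by positivity), mul_comm]
  exact h m hm

theorem renorm_pow_mul_eigval_monotone (hp₀ : 0 < p) (hp : p < 1 / 2) {n₀ k : ℕ}
    (hk : k ≤ 3 ^ n₀) {m n : ℕ} (hm : n₀ ≤ m) (hn : m ≤ n) :
    renorm p ^ m * eigval p m k ≤ renorm p ^ n * eigval p n k := by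
  induction n, hn using Nat.le_induction with
  | base => exact le_rfl
  | succ n hn ih =>
    refine ih.trans ?_
    obtain ⟨h1, h2⟩ := eigval_succ hp₀ hp
      (hk.trans (Nat.pow_le_pow_right (by norm_num) (hm.trans hn)) : k ≤ 3 ^ n)
    have hc : 0 < renorm p := one_pos.trans (one_lt_renorm hp₀ (by linarith))
    rw [← sub_nonneg, renorm_pow_mul_increment hp₀ (by linarith) n h2]
    have hz := h1.1
    refine mul_nonneg (by positivity) (div_nonneg ?_ (mul_pos hp₀ (by linarith)).le)
    nlinarith [mul_nonneg (mul_nonneg hz hz) (show 0 ≤ 3 - eigval p (n + 1) k by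
      linarith [h1.2])]

/-- An increment is C₀^m · O(λ_{m+1,k}²), and λ_{m,k} = O(C₀^{-m}), so the increments are
O(C₀^{-m}). -/
theorem limEigval_spec (hp₀ : 0 < p) (hp : p < 1 / 2) {n₀ k : ℕ} (hk : k ≤ 3 ^ n₀) :
    Tendsto (fun n : ℕ => renorm p ^ n * eigval p n k) atTop (𝓝 (limEigval p k)) ∧
    ∃ C : ℝ, ∀ m, n₀ ≤ m →
      |renorm p ^ m * eigval p m k - limEigval p k| ≤ C * (renorm p)⁻¹ ^ m := by
  obtain ⟨M, hM, hlam⟩ := eigval_le_geometric hp₀ hp hk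
  have hc1 := one_lt_renorm hp₀ (show p < 1 by linarith)
  have hc : 0 < renorm p := one_pos.trans hc1
  have hr : (renorm p)⁻¹ < 1 := inv_lt_one_of_one_lt₀ hc1
  have hpq : 0 < p * (1 - p) := mul_pos hp₀ (by linarith)
  obtain ⟨l, hl, hl'⟩ := exists_limit_of_geometric (a := fun n => renorm p ^ n * eigval p n k)
    (K := 3 * M ^ 2 / (p * (1 - p))) hr n₀ fun m hm => by
      have hkm : k ≤ 3 ^ m := hk.trans (Nat.pow_le_pow_right (by norm_num) hm)
      obtain ⟨h1, h2⟩ := eigval_succ hp₀ hp hkm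
      have hmono := renorm_pow_mul_eigval_monotone hp₀ hp hk hm (Nat.le_succ m)
      rw [abs_of_nonneg (sub_nonneg.2 hmono), renorm_pow_mul_increment hp₀ (by linarith) m h2]
      have hz := h1.1
      have hz' : eigval p (m + 1) k ≤ M * (renorm p)⁻¹ ^ m :=
        (hlam _ (by omega)).trans (mul_le_mul_of_nonneg_left
          (pow_le_pow_of_le_one (by positivity) hr.le (Nat.le_succ m)) hM)
      calc renorm p ^ m * ((3 * eigval p (m + 1) k ^ 2 - eigval p (m + 1) k ^ 3) / (p * (1 - p)))
          ≤ renorm p ^ m * ((3 * (M * (renorm p)⁻¹ ^ m) ^ 2) / (p * (1 - p))) := by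
            have := pow_nonneg hz 3
            have := pow_le_pow_left₀ hz hz' 2
            gcongr
            linarith
        _ = _ := by
            rw [inv_pow]
            field_simp
  have : limEigval p k = l := hl.limUnder_eq
  rw [this]
  exact ⟨hl, _, hl'⟩

theorem le_limEigval (hp₀ : 0 < p) (hp : p < 1 / 2) {n k : ℕ} (hk : k ≤ 3 ^ n) :
    renorm p ^ n * eigval p n k ≤ limEigval p k :=
  ge_of_tendsto (limEigval_spec hp₀ hp hk).1 ((eventually_ge_atTop n).mono fun _ hm =>
    renorm_pow_mul_eigval_monotone hp₀ hp hk le_rfl hm)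

theorem limEigval_pos (hp₀ : 0 < p) (hp : p < 1 / 2) {k : ℕ} (hk : 0 < k) :
    0 < limEigval p k := by
  have hc : 0 < renorm p := one_pos.trans (one_lt_renorm hp₀ (by linarith))
  have hk' : k ≤ 3 ^ k := (Nat.lt_pow_self (by norm_num)).le
  exact (mul_pos (pow_pos hc k) (eigval_pos hp₀ hp hk hk')).trans_le (le_limEigval hp₀ hp hk')

theorem limEigval_zero (hp₀ : 0 < p) (hp : p < 1 / 2) : limEigval p 0 = 0 :=
  tendsto_nhds_unique (limEigval_spec hp₀ hp (n₀ := 0) (zero_le)).1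
    (by simp [eigval_zero hp₀ hp])

/-- The renormalized frequencies converge at the rate `C₀⁻ⁿ`. -/
theorem sqrt_eigval_sub_le (hp₀ : 0 < p) (hp : p < 1 / 2) {n₀ k : ℕ} (hk : k ≤ 3 ^ n₀) :
    ∃ C : ℝ, ∀ m, n₀ ≤ m →
      |√(renorm p ^ m * eigval p m k) - √(limEigval p k)| ≤ C * (renorm p)⁻¹ ^ m := by
  -- The mode k = 0 is separate: the square root is not Lipschitz at 0, but there both terms vanish.
  rcases Nat.eq_zero_or_pos k with rfl | hk0
  · exact ⟨0, fun m _ => by simp [eigval_zero hp₀ hp, limEigval_zero hp₀ hp]⟩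
  obtain ⟨C, hC⟩ := (limEigval_spec hp₀ hp hk).2
  have hl := limEigval_pos hp₀ hp hk0
  refine ⟨C / √(limEigval p k), fun m hm => ?_⟩
  have hc : 0 < renorm p := one_pos.trans (one_lt_renorm hp₀ (by linarith))
  have he : 0 ≤ renorm p ^ m * eigval p m k := mul_nonneg (by positivity)
    (eigval_mem_Icc hp₀ hp (hk.trans (Nat.pow_le_pow_right (by norm_num) hm))).1
  rw [div_mul_eq_mul_div, le_div_iff₀ (Real.sqrt_pos.2 hl)]
  refine le_trans ?_ (hC m hm)
  -- Factor a² - b² = (a - b)(a + b); the second factor is at least √λ_k.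
  conv_rhs => rw [← Real.sq_sqrt he, ← Real.sq_sqrt hl.le, sq_sub_sq, mul_comm, abs_mul]
  gcongr
  refine le_trans ?_ (le_abs_self _)
  linarith [Real.sqrt_nonneg (renorm p ^ m * eigval p m k)]

theorem abs_div_sub_div_le {a b a' b' β : ℝ} (hβ : 0 < β) (hb : β ≤ b) (hb' : β ≤ b') :
    |a / b - a' / b'| ≤ |a - a'| / β + |a'| * |b - b'| / β ^ 2 := by
  have h0 := hβ.trans_le hb
  have h0' := hβ.trans_le hb'
  have e : a / b - a' / b' = (a - a') / b + -(a' * (b - b') / (b * b')) := by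
    field_simp
    ring
  rw [e]
  refine (abs_add_le _ _).trans (add_le_add ?_ ?_)
  · rw [abs_div, abs_of_pos h0]
    gcongr
  · rw [abs_neg, abs_div, abs_mul, abs_of_pos (mul_pos h0 h0'), sq]
    gcongr

theorem frequency_ratio_sub_le (hp₀ : 0 < p) (hp : p < 1 / 2) {n₀ k : ℕ} (hk : k ≤ 3 ^ n₀) :
    ∃ C : ℝ, ∀ m, n₀ ≤ m →
      |√(eigval p m k) / √(eigval p m 1) - √(limEigval p k) / √(limEigval p 1)| ≤
        C * (renorm p)⁻¹ ^ m := by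
  obtain ⟨C₁, h₁⟩ := sqrt_eigval_sub_le hp₀ hp hk
  obtain ⟨C₂, h₂⟩ := sqrt_eigval_sub_le hp₀ hp (n₀ := n₀) (k := 1) (Nat.one_le_pow _ _ (by norm_num))
  have hc : 0 < renorm p := one_pos.trans (one_lt_renorm hp₀ (by linarith))
  -- By monotonicity the value at level 0 bounds from below all renormalized first eigenvalues and
  -- their limit, which keeps the denominators away from 0.
  set s := renorm p ^ 0 * eigval p 0 1 with hs_def
  have h01 : 1 ≤ 3 ^ 0 := by norm_num
  have hs : 0 < s := mul_pos (by positivity) (eigval_pos hp₀ hp one_pos h01)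
  refine ⟨C₁ / √s + |√(limEigval p k)| * C₂ / √s ^ 2, fun m hm => ?_⟩
  have hcm : √(renorm p ^ m) ≠ 0 := (Real.sqrt_pos.2 (by positivity)).ne'
  have e : √(eigval p m k) / √(eigval p m 1) =
      √(renorm p ^ m * eigval p m k) / √(renorm p ^ m * eigval p m 1) := by
    rw [Real.sqrt_mul (by positivity), Real.sqrt_mul (by positivity), mul_div_mul_left _ _ hcm]
  rw [e]
  refine (abs_div_sub_div_le (Real.sqrt_pos.2 hs)
    (Real.sqrt_le_sqrt (renorm_pow_mul_eigval_monotone hp₀ hp h01 le_rfl (zero_le)))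
    (Real.sqrt_le_sqrt (le_limEigval hp₀ hp h01))).trans ?_
  calc _ ≤ C₁ * (renorm p)⁻¹ ^ m / √s +
        |√(limEigval p k)| * (C₂ * (renorm p)⁻¹ ^ m) / √s ^ 2 := by
        gcongr
        · exact h₁ m hm
        · exact h₂ m hm
    _ = _ := by ring

/-! ### Limits of eigenfunctions -/

theorem abs_refineFun_le {A B S G : ℝ} {f : ℕ → ℝ} {N : ℕ} (hf : ∀ i ≤ N, |f i| ≤ G)
    (hAB : |A| + |B| ≤ S) (hS : 1 ≤ S) : ∀ i ≤ 3 * N, |refineFun A B f i| ≤ S * G := by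
  have hG : 0 ≤ G := (abs_nonneg _).trans (hf 0 (zero_le))
  have hcomb : ∀ {a b u v : ℝ}, |a| + |b| ≤ S → |u| ≤ G → |v| ≤ G →
      |a * u + b * v| ≤ S * G := by
    intro a b u v hab hu hv
    calc |a * u + b * v| ≤ |a| * |u| + |b| * |v| := by
          rw [← abs_mul, ← abs_mul]
          exact abs_add_le _ _
      _ ≤ |a| * G + |b| * G := by gcongr
      _ = (|a| + |b|) * G := by ring
      _ ≤ S * G := by gcongr
  intro i hi
  unfold refineFun
  split_ifs with h h'
  · exact (hf _ (by omega)).trans (le_mul_of_one_le_left hG hS)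
  · exact hcomb hAB (hf _ (by omega)) (hf _ (by omega))
  · exact hcomb (by linarith) (hf _ (by omega)) (hf _ (by omega))

theorem abs_refineFun_sub_le {A B A' B' G : ℝ} {f : ℕ → ℝ} {N : ℕ} (hf : ∀ i ≤ N, |f i| ≤ G) :
    ∀ i ≤ 3 * N, |refineFun A B f i - refineFun A' B' f i| ≤ (|A - A'| + |B - B'|) * G := by
  have hG : 0 ≤ G := (abs_nonneg _).trans (hf 0 (zero_le))
  have hcomb : ∀ {a b u v : ℝ}, |u| ≤ G → |v| ≤ G → |a * u + b * v| ≤ (|a| + |b|) * G := by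
    intro a b u v hu hv
    calc |a * u + b * v| ≤ |a| * |u| + |b| * |v| := by
          rw [← abs_mul, ← abs_mul]
          exact abs_add_le _ _
      _ ≤ |a| * G + |b| * G := by gcongr
      _ = (|a| + |b|) * G := by ring
  intro i hi
  unfold refineFun
  split_ifs with h h'
  · rw [sub_self, abs_zero]
    positivity
  · rw [add_sub_add_comm, ← sub_mul, ← sub_mul]
    exact hcomb (hf _ (by omega)) (hf _ (by omega))
  · rw [add_sub_add_comm, ← sub_mul, ← sub_mul, add_comm |A - A'|]
    exact hcomb (hf _ (by omega)) (hf _ (by omega))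

/-! ### Extension coefficients for small eigenvalues -/

theorem nearCoeff_nonneg (hp₀ : 0 < p) (hp : p < 1 / 2) {z : ℝ} (hz : z ∈ Set.Icc 0 p) :
    0 ≤ nearCoeff p z :=
  div_nonneg (mul_nonneg (by linarith) (by linarith [hz.2])) (cellDet_pos hp₀ hp hz).le

theorem farCoeff_nonneg (hp₀ : 0 < p) (hp : p < 1 / 2) {z : ℝ} (hz : z ∈ Set.Icc 0 p) :
    0 ≤ farCoeff p z :=
  div_nonneg (mul_nonneg hp₀.le (by linarith)) (cellDet_pos hp₀ hp hz).le

/-- This sum is the growth factor of the sup norm in one extension step; it exceeds 1 only by a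
multiple of the eigenvalue. -/
theorem nearCoeff_add_farCoeff_le (hp₀ : 0 < p) (hp : p < 1 / 2) {z : ℝ}
    (hz : z ∈ Set.Icc 0 p) : nearCoeff p z + farCoeff p z ≤ 1 + z / (1 - 2 * p) := by
  have h1 : 0 < 1 - p - z := by linarith [hz.2]
  have h2 : 0 < 1 + p - z := by linarith [hz.2]
  have h3 : 0 < 1 - 2 * p := by linarith
  have e : nearCoeff p z + farCoeff p z = 1 + z / (1 - p - z) := by
    rw [nearCoeff, farCoeff, cellDet]
    field_simp
    ring
  rw [e]
  exact add_le_add_right (div_le_div_of_nonneg_left hz.1 h3 (by linarith [hz.2])) 1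

theorem le_cellDet (hp₀ : 0 < p) (hp : p < 1 / 2) {z : ℝ} (hz : z ∈ Set.Icc 0 p) :
    1 - 2 * p ≤ (1 + p) * cellDet p z := by
  have h1 : 1 - 2 * p ≤ 1 - p - z := by linarith [hz.2]
  have h2 : 1 ≤ 1 + p - z := by linarith [hz.2]
  have h3 : 1 - 2 * p ≤ cellDet p z :=
    h1.trans (le_mul_of_one_le_right (by linarith [hz.2]) h2)
  nlinarith

/-- At z = 0 the coefficient is 1/(1+p), that of harmonic extension; the error is linear in z
because `cellDet` stays away from 0 on [0,p]. -/
theorem abs_nearCoeff_sub_le (hp₀ : 0 < p) (hp : p < 1 / 2) {z : ℝ} (hz : z ∈ Set.Icc 0 p) :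
    |nearCoeff p z - 1 / (1 + p)| ≤ 2 / (1 - 2 * p) * z := by
  have hD := cellDet_pos hp₀ hp hz
  have h3 : 0 < 1 - 2 * p := by linarith
  have hz0 := hz.1
  have e : nearCoeff p z - 1 / (1 + p) =
      z * (2 - (1 - p) * (1 + p) - z) / ((1 + p) * cellDet p z) := by
    rw [nearCoeff]
    field_simp
    rw [cellDet]
    ring
  rw [e, abs_div, abs_mul, abs_of_nonneg hz0, abs_of_pos (by positivity : 0 < (1 + p) * _),
    div_mul_eq_mul_div, mul_comm 2 z]
  have : |2 - (1 - p) * (1 + p) - z| ≤ 2 := by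
    rw [abs_le]
    constructor <;> nlinarith [hz.2]
  gcongr
  exact le_cellDet hp₀ hp hz

theorem abs_farCoeff_sub_le (hp₀ : 0 < p) (hp : p < 1 / 2) {z : ℝ} (hz : z ∈ Set.Icc 0 p) :
    |farCoeff p z - p / (1 + p)| ≤ 2 / (1 - 2 * p) * z := by
  have hD := cellDet_pos hp₀ hp hz
  have h3 : 0 < 1 - 2 * p := by linarith
  have hz0 := hz.1
  have e : farCoeff p z - p / (1 + p) = z * (p * (2 - z)) / ((1 + p) * cellDet p z) := by
    rw [farCoeff]
    field_simp
    rw [cellDet]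
    ring
  rw [e, abs_div, abs_mul, abs_of_nonneg hz0, abs_of_pos (by positivity : 0 < (1 + p) * _),
    div_mul_eq_mul_div, mul_comm 2 z]
  have : |p * (2 - z)| ≤ 2 := by
    rw [abs_le]
    constructor <;> nlinarith [hz.2]
  gcongr
  exact le_cellDet hp₀ hp hz

/-- The sup norm is multiplied by at most 1 + λ_{m,k}/(1 - 2p) on reaching level m, and these
factors have a bounded product because the λ_{m,k} are dominated by a geometric series. -/
theorem eigfun_bounded (hp₀ : 0 < p) (hp : p < 1 / 2) {n₀ k : ℕ} (hk : k ≤ 3 ^ n₀) :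
    ∃ G : ℝ, 0 ≤ G ∧ ∀ m, n₀ ≤ m → ∀ i ≤ 3 ^ m, |natExt (eigfun p m k) i| ≤ G := by
  obtain ⟨M, hM, hlam⟩ := eigval_le_geometric hp₀ hp hk
  have hc1 := one_lt_renorm hp₀ (show p < 1 by linarith)
  set r := (renorm p)⁻¹ with hr_def
  have hr : r < 1 := inv_lt_one_of_one_lt₀ hc1
  have hr0 : 0 < r := inv_pos.2 (one_pos.trans hc1)
  have h3 : 0 < 1 - 2 * p := by linarith
  have h1r : 0 < 1 - r := by linarith
  set G₀ := ∑ i ∈ Finset.range (3 ^ n₀ + 1), |natExt (eigfun p n₀ k) i|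
  have hG₀ : 0 ≤ G₀ := Finset.sum_nonneg fun _ _ => abs_nonneg _
  -- The exponent K - K r^m grows by K(1 - r) r^m at each level, which covers λ_{m+1,k}/(1 - 2p).
  set K := M / (1 - 2 * p) / (1 - r)
  have hK : 0 ≤ K := by positivity
  have hKe : K * (1 - r) = M / (1 - 2 * p) := div_mul_cancel₀ _ h1r.ne'
  have key : ∀ m, n₀ ≤ m → ∀ i ≤ 3 ^ m,
      |natExt (eigfun p m k) i| ≤ Real.exp (K - K * r ^ m) * G₀ := by
    intro m hm
    induction m, hm using Nat.le_induction with
    | base =>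
      intro i hi
      have h1 : |natExt (eigfun p n₀ k) i| ≤ G₀ :=
        Finset.single_le_sum (f := fun i => |natExt (eigfun p n₀ k) i|)
          (fun _ _ => abs_nonneg _) (Finset.mem_range.2 (Nat.lt_succ_iff.2 hi))
      refine h1.trans (le_mul_of_one_le_left hG₀ (Real.one_le_exp (sub_nonneg.2 ?_)))
      exact mul_le_of_le_one_right hK (pow_le_one₀ hr0.le hr.le)
    | succ m hm ih =>
      intro i hi
      have hkm : k ≤ 3 ^ m := hk.trans (Nat.pow_le_pow_right (by norm_num) hm)
      have hz := (eigval_succ hp₀ hp hkm).1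
      set z := eigval p (m + 1) k
      rw [eigfun_succ hp₀ hp hkm i hi]
      have hS : |nearCoeff p z| + |farCoeff p z| ≤ 1 + z / (1 - 2 * p) := by
        rw [abs_of_nonneg (nearCoeff_nonneg hp₀ hp hz), abs_of_nonneg (farCoeff_nonneg hp₀ hp hz)]
        exact nearCoeff_add_farCoeff_le hp₀ hp hz
      have hz0 := hz.1
      refine (abs_refineFun_le ih hS (le_add_of_nonneg_right (by positivity)) i
        (by rwa [← pow_succ'])).trans ?_
      rw [← mul_assoc]
      refine mul_le_mul_of_nonneg_right ?_ hG₀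
      have hexp : 1 + z / (1 - 2 * p) ≤ Real.exp (z / (1 - 2 * p)) := by
        rw [add_comm]
        exact Real.add_one_le_exp _
      refine (mul_le_mul_of_nonneg_right hexp (Real.exp_nonneg _)).trans ?_
      rw [← Real.exp_add, Real.exp_le_exp]
      have hz2 : z / (1 - 2 * p) ≤ K * (1 - r) * r ^ (m + 1) := by
        rw [hKe, div_mul_eq_mul_div]
        gcongr
        exact hlam (m + 1) (by omega)
      have : K * (1 - r) * r ^ (m + 1) ≤ K * (1 - r) * r ^ m :=
        mul_le_mul_of_nonneg_left (pow_le_pow_of_le_one hr0.le hr.le (Nat.le_succ m))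
          (by positivity)
      rw [show K * (1 - r) * r ^ m = K * r ^ m - K * r ^ (m + 1) by ring] at this
      linarith
  refine ⟨Real.exp K * G₀, by positivity, fun m hm i hi => (key m hm i hi).trans ?_⟩
  gcongr
  exact sub_le_self _ (by positivity)

theorem harmExt_natExt (p : ℝ) {n : ℕ} (u : Fin (3 ^ n + 1) → ℝ) (x : ℝ) :
    harmExt p n (fun i => natExt u i) x = harmExt p n u x := by
  simp only [natExt_coe]

/-- The constants are uniform in x because the maximum principle reduces the comparison of
consecutive levels to the vertices. -/
theorem limEigfun_spec (hp₀ : 0 < p) (hp : p < 1 / 2) {n₀ k : ℕ} (hk : k ≤ 3 ^ n₀) :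
    ∃ G C : ℝ, ∀ x, |limEigfun p k x| ≤ G ∧
      ∀ m, n₀ ≤ m → |harmExt p m (eigfun p m k) x - limEigfun p k x| ≤ C * (renorm p)⁻¹ ^ m := by
  obtain ⟨M, hM, hlam⟩ := eigval_le_geometric hp₀ hp hk
  obtain ⟨G, hG, hbd⟩ := eigfun_bounded hp₀ hp hk
  have hc1 := one_lt_renorm hp₀ (show p < 1 by linarith)
  set r := (renorm p)⁻¹ with hr_def
  have hr : r < 1 := inv_lt_one_of_one_lt₀ hc1
  have hr0 : 0 < r := inv_pos.2 (one_pos.trans hc1)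
  have h3 : 0 < 1 - 2 * p := by linarith
  set K := 4 / (1 - 2 * p) * M * G
  refine ⟨G, K / (1 - r), fun x => ?_⟩
  have hstep : ∀ m, n₀ ≤ m →
      |harmExt p (m + 1) (eigfun p (m + 1) k) x - harmExt p m (eigfun p m k) x| ≤ K * r ^ m := by
    intro m hm
    have hkm : k ≤ 3 ^ m := hk.trans (Nat.pow_le_pow_right (by norm_num) hm)
    have hz := (eigval_succ hp₀ hp hkm).1
    -- The extension from level m is rewritten as one from level m + 1, so that both functions live
    -- on the same vertices.
    rw [← harmExt_natExt p (eigfun p m k), ← harmExt_refine hp₀ (by linarith),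
      ← harmExt_natExt p (eigfun p (m + 1) k), ← harmExt_sub]
    refine abs_harmExt_le hp₀ (by linarith) (g := fun i => natExt (eigfun p (m + 1) k) i -
      refineFun (1 / (1 + p)) (p / (1 + p)) (natExt (eigfun p m k)) i) (fun i hi => ?_) x
    rw [eigfun_succ hp₀ hp hkm i hi]
    refine (abs_refineFun_sub_le (hbd m hm) i (by rwa [← pow_succ'])).trans ?_
    have hA := abs_nearCoeff_sub_le hp₀ hp hz
    have hB := abs_farCoeff_sub_le hp₀ hp hz
    calc _ ≤ (2 / (1 - 2 * p) * eigval p (m + 1) k + 2 / (1 - 2 * p) * eigval p (m + 1) k) * G := by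
          gcongr
      _ = 4 / (1 - 2 * p) * eigval p (m + 1) k * G := by ring
      _ ≤ 4 / (1 - 2 * p) * (M * r ^ m) * G := by
          gcongr
          exact (hlam _ (by omega)).trans (mul_le_mul_of_nonneg_left
            (pow_le_pow_of_le_one hr0.le hr.le (Nat.le_succ m)) hM)
      _ = K * r ^ m := by ring
  obtain ⟨l, hl, hl'⟩ := exists_limit_of_geometric
    (a := fun m => harmExt p m (eigfun p m k) x) hr n₀ hstep
  have hlim : limEigfun p k x = l := hl.limUnder_eq
  rw [hlim]
  refine ⟨le_of_tendsto hl.abs ((eventually_ge_atTop n₀).mono fun m hm => ?_), hl'⟩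
  rw [← harmExt_natExt]
  exact abs_harmExt_le hp₀ (by linarith) (hbd m hm) x

theorem tendstoUniformlyOn_eigfun (hp₀ : 0 < p) (hp : p < 1 / 2) (k : ℕ) (s : Set ℝ) :
    TendstoUniformlyOn (fun (n : ℕ) (x : ℝ) => harmExt p n (eigfun p n k) x)
      (limEigfun p k) atTop s := by
  have hk : k ≤ 3 ^ k := (Nat.lt_pow_self (by norm_num)).le
  obtain ⟨G, C, h⟩ := limEigfun_spec hp₀ hp hk
  have hc1 := one_lt_renorm hp₀ (show p < 1 by linarith)
  have hlim : Tendsto (fun m : ℕ => C * (renorm p)⁻¹ ^ m) atTop (𝓝 0) := by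
    simpa using (tendsto_pow_atTop_nhds_zero_of_lt_one
      (inv_pos.2 (one_pos.trans hc1)).le (inv_lt_one_of_one_lt₀ hc1)).const_mul C
  rw [Metric.tendstoUniformlyOn_iff]
  intro ε hε
  filter_upwards [hlim.eventually_lt_const hε, eventually_ge_atTop k] with m hm hkm x _
  rw [dist_comm, Real.dist_eq]
  exact ((h x).2 m hkm).trans_lt hm

end Limits

/-! ### The error estimate -/

section Wave

variable {p : ℝ}

theorem abs_mul_cos_sub_le {a b G s t : ℝ} (hb : |b| ≤ G) :
    |a * Real.cos s - b * Real.cos t| ≤ |a - b| + G * |s - t| := by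
  have e : a * Real.cos s - b * Real.cos t =
      (a - b) * Real.cos s + b * (Real.cos s - Real.cos t) := by ring
  rw [e]
  refine (abs_add_le _ _).trans (add_le_add ?_ ?_)
  · rw [abs_mul]
    exact mul_le_of_le_one_right (abs_nonneg _) (Real.abs_cos_le_one s)
  · rw [abs_mul]
    have hcos : |Real.cos s - Real.cos t| ≤ |s - t| := Real.abs_cos_sub_cos_le s t
    exact mul_le_mul hb hcos (abs_nonneg _) ((abs_nonneg _).trans hb)

/-- The amplitude error carries no t and the phase error is linear in t, whence the factor max t 1.
-/
theorem mode_sub_le (hp₀ : 0 < p) (hp : p < 1 / 2) {n₀ k : ℕ} (hk : k ≤ 3 ^ n₀) :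
    ∃ C : ℝ, 0 ≤ C ∧ ∀ t : ℝ, 0 ≤ t → ∀ n, n₀ ≤ n → ∀ x : ℝ,
      |harmExt p n (eigfun p n k) x *
            Real.cos (t * Real.pi / √(eigval p n 1) * √(eigval p n k)) -
          limEigfun p k x *
            Real.cos (t * Real.pi / √(limEigval p 1) * √(limEigval p k))| ≤
        C * max t 1 * (renorm p)⁻¹ ^ n := by
  obtain ⟨G, C₁, h₁⟩ := limEigfun_spec hp₀ hp hk
  obtain ⟨C₂, h₂⟩ := frequency_ratio_sub_le hp₀ hp hk
  have hG : 0 ≤ G := (abs_nonneg _).trans (h₁ 0).1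
  have hc : 0 < renorm p := one_pos.trans (one_lt_renorm hp₀ (by linarith))
  refine ⟨|C₁| + G * Real.pi * |C₂|, by positivity, fun t ht n hn x => ?_⟩
  refine (abs_mul_cos_sub_le (h₁ x).1).trans ?_
  have e : t * Real.pi / √(eigval p n 1) * √(eigval p n k) -
      t * Real.pi / √(limEigval p 1) * √(limEigval p k) = t * Real.pi *
        (√(eigval p n k) / √(eigval p n 1) - √(limEigval p k) / √(limEigval p 1)) := by ring
  rw [e, abs_mul, abs_of_nonneg (by positivity : 0 ≤ t * Real.pi)]
  have hr : 0 ≤ (renorm p)⁻¹ ^ n := by positivity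
  have a1 : |harmExt p n (eigfun p n k) x - limEigfun p k x| ≤
      |C₁| * max t 1 * (renorm p)⁻¹ ^ n := by
    refine ((h₁ x).2 n hn).trans (mul_le_mul_of_nonneg_right ?_ hr)
    exact (le_abs_self _).trans (le_mul_of_one_le_right (abs_nonneg _) (le_max_right _ _))
  have a2 : |√(eigval p n k) / √(eigval p n 1) - √(limEigval p k) / √(limEigval p 1)| ≤
      |C₂| * (renorm p)⁻¹ ^ n :=
    (h₂ n hn).trans (mul_le_mul_of_nonneg_right (le_abs_self _) hr)
  calc _ ≤ |C₁| * max t 1 * (renorm p)⁻¹ ^ n +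
        G * (max t 1 * Real.pi * (|C₂| * (renorm p)⁻¹ ^ n)) := by
        gcongr
        exact le_max_left _ _
    _ = _ := by ring

theorem wave_sub_le (hp₀ : 0 < p) (hp : p < 1 / 2) (n₀ : ℕ) :
    ∃ C : ℝ, 0 < C ∧ ∀ t : ℝ, 0 ≤ t → ∀ n, n₀ ≤ n → ∀ x : ℝ,
      |waveApprox p n₀ n x (t * Real.pi / √(eigval p n 1)) -
          waveLimit p n₀ x (t * Real.pi / √(limEigval p 1))| ≤
        C * max t 1 * (renorm p ^ n)⁻¹ := by
  choose C hC h using fun k : Fin (3 ^ n₀ + 1) =>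
    mode_sub_le hp₀ hp (n₀ := n₀) (Nat.lt_succ_iff.1 k.isLt)
  have hc : 0 < renorm p := one_pos.trans (one_lt_renorm hp₀ (by linarith))
  have hsum : 0 ≤ ∑ k : Fin (3 ^ n₀ + 1), |coeff p n₀ k| * C k :=
    Finset.sum_nonneg fun k _ => mul_nonneg (abs_nonneg _) (hC k)
  -- The summand 1 only makes the constant positive.
  refine ⟨∑ k : Fin (3 ^ n₀ + 1), |coeff p n₀ k| * C k + 1, by linarith,
    fun t ht n hn x => ?_⟩
  set T := t * Real.pi / √(eigval p n 1)
  set T' := t * Real.pi / √(limEigval p 1)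
  have e : waveApprox p n₀ n x T = ∑ k : Fin (3 ^ n₀ + 1),
      coeff p n₀ k * Real.cos (T * √(eigval p n k)) * harmExt p n (eigfun p n k) x := by
    rw [← harmExt_sum, waveApprox]
    congr 1
    funext i
    exact Finset.sum_congr rfl fun k _ => by ring
  rw [e, waveLimit, ← Finset.sum_sub_distrib, ← inv_pow]
  refine (Finset.abs_sum_le_sum_abs _ _).trans ?_
  calc _ ≤ ∑ k : Fin (3 ^ n₀ + 1),
        |coeff p n₀ k| * (C k * max t 1 * (renorm p)⁻¹ ^ n) := by
        refine Finset.sum_le_sum fun k _ => ?_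
        rw [mul_right_comm, mul_assoc, mul_assoc, ← mul_sub, abs_mul]
        exact mul_le_mul_of_nonneg_left (h k t ht n hn x) (abs_nonneg _)
    _ = (∑ k : Fin (3 ^ n₀ + 1), |coeff p n₀ k| * C k) * max t 1 * (renorm p)⁻¹ ^ n := by
        rw [Finset.sum_mul, Finset.sum_mul]
        exact Finset.sum_congr rfl fun k _ => by ring
    _ ≤ _ := by
        gcongr
        linarith

end Wave

end FractalWave

end

theorem theorem5p1 (p : ℝ) (hp₀ : 0 < p) (hp : p < 1 / 2) :
    -- the objects are well defined: eigenvalues, normalized eigenfunctions, weights, limits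
    (∀ n : ℕ, StrictMonoOn (eigval p n) (Set.Iic (3 ^ n)) ∧
      eigSet p n = eigval p n '' Set.Iic (3 ^ n) ∧
      (∀ k ≤ 3 ^ n, (lap p n).mulVec (eigfun p n k) = eigval p n k • eigfun p n k ∧
        eigfun p n k 0 = 1) ∧
      (∑ k : Fin (3 ^ n + 1), coeff p n k • eigfun p n k = Pi.single 0 1) ∧
      0 < eigval p n 1) ∧
    (∀ k : ℕ,
      Tendsto (fun n : ℕ => renorm p ^ n * eigval p n k) atTop (𝓝 (limEigval p k)) ∧
      TendstoUniformlyOn (fun (n : ℕ) (x : ℝ) => harmExt p n (eigfun p n k) x)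
        (limEigfun p k) atTop (Set.Icc 0 1) ∧
      ContinuousOn (limEigfun p k) (Set.Icc 0 1)) ∧
    0 < limEigval p 1 ∧
    -- the error estimate
    ∀ n₀ : ℕ, ∃ C : ℝ, 0 < C ∧ ∀ t : ℝ, 0 ≤ t → ∀ n : ℕ, n₀ < n → ∀ x ∈ Set.Icc (0 : ℝ) 1,
      |waveApprox p n₀ n x (t * Real.pi / √(eigval p n 1)) -
          waveLimit p n₀ x (t * Real.pi / √(limEigval p 1))| ≤
        C * max t 1 * (renorm p ^ n)⁻¹ := by
  refine ⟨fun n => ⟨?_, ?_, ?_, coeff_spec hp₀ hp n,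
      eigval_pos hp₀ hp one_pos (Nat.one_le_pow _ _ (by norm_num))⟩,
    fun k => ⟨?_, tendstoUniformlyOn_eigfun hp₀ hp k _, ?_⟩, limEigval_pos hp₀ hp one_pos,
    fun n₀ => ?_⟩
  · exact (specList_strictMonoOn hp₀ hp n).congr fun k hk => (eigval_eq hp₀ hp hk).symm
  · rw [eigSet_eq hp₀ hp]
    exact Set.image_congr fun k hk => (eigval_eq hp₀ hp hk).symm
  · exact fun k hk => eigfun_spec hp₀ hp hk
  · exact (limEigval_spec hp₀ hp (Nat.lt_pow_self (by norm_num : 1 < 3)).le).1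
  · exact (tendstoUniformlyOn_eigfun hp₀ hp k _).continuousOn
      (Frequently.of_forall fun n => (continuous_harmExt p n _).continuousOn)
  · obtain ⟨C, hC, h⟩ := wave_sub_le hp₀ hp n₀
    exact ⟨C, hC, fun t ht n hn x _ => h t ht n hn.le x⟩
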